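/- For positive integers $k_1,\dots,k_r$ let $$\mathrm{Li}_{k_1,\dots,k_r}(z_1,\dots,z_r)=\sum_{0<n_1<\cdots<n_r}\frac{z_1^{n_1}z_2^{n_2-n_1}\cdots z_r^{n_r-n_{r-1}}}{n_1^{k_1}\cdots n_r^{k_r}}\qquad(|z_j|<1),$$ and denote by the same symbol its holomorphic continuation to $(\mathbb{C}\setminus\mathbb{R}_{\ge 1})^r$. For positive integers $k_1,\dots,k_r,l_1,\dots,l_r$ put $$\eta(k_1,\dots,k_r;l_1,\dots,l_r)=\prod_{j=1}^r\frac{1}{\Gamma(l_j)}\int_{(0,\infty)^r}\frac{\mathrm{Li}_{k_1,\dots,k_r}\bigl(1-e^{t_1+\cdots+t_r},1-e^{t_2+\cdots+t_r},\dots,1-e^{t_r}\bigr)}{\prod_{j=1}^r\bigl(1-e^{t_j+\cdots+t_r}\bigr)}\prod_{j=1}^r t_j^{l_j-1}\,dt_j .$$ For an integer $w\ge 0$ let $\mathcal{Z}_w\subset\mathbb{R}$ be the $\mathbb{Q}$-vector space spanned by the multiple zeta values $$\zeta(k_1,\dots,k_r)=\sum_{0<n_1<\cdots<n_r}\frac{1}{n_1^{k_1}\cdots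 n_r^{k_r}}$$ with $r\ge 0$, $k_1,\dots,k_r$ positive integers, $k_1+\cdots+k_r=w$, and $k_r>1$ if $r>0$ (with $\zeta(\varnothing)=1$). **Theorem.** For all integers $k,l>0$ the integral defining $\eta(1,k;1,l)$ converges absolutely, and $$\eta(1,k;1,l)\in\mathcal{Z}_{k+l+2}.$$ -/

import Mathlib

open MeasureTheory

namespace EtaMZV

/-- The tuples of integers `0 < n₁ < ⋯ < n_r`. -/
abbrev IncTuple (r : ℕ) : Type := {n : Fin r → ℕ // StrictMono n ∧ ∀ i, 0 < n i}

/-- Admissible index: all entries are positive and the last one (if any) exceeds `1`.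
The empty index is admissible. -/
def IsAdmissible {r : ℕ} (k : Fin r → ℕ) : Prop :=
  (∀ i, 0 < k i) ∧ ∀ i : Fin r, (i : ℕ) + 1 = r → 1 < k i

/-- The multiple zeta value `ζ(k₁,…,k_r) = ∑_{0<n₁<⋯<n_r} 1 / (n₁^{k₁} ⋯ n_r^{k_r})`
(an absolutely convergent series of positive terms for admissible `k`). -/
noncomputable def mzv {r : ℕ} (k : Fin r → ℕ) : ℝ :=
  ∑' n : IncTuple r, ∏ i, 1 / (n.1 i : ℝ) ^ k i

/-- The `ℚ`-subspace of `ℝ` spanned by the multiple zeta values of weight `w`. -/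
noncomputable def mzvSpan (w : ℕ) : Submodule ℚ ℝ :=
  Submodule.span ℚ {x : ℝ | ∃ (r : ℕ) (k : Fin r → ℕ),
    IsAdmissible k ∧ ∑ i, k i = w ∧ x = mzv k}

/-- The difference `n_i - n_{i-1}`, where the term before the first one is `0`. -/
def gap {r : ℕ} (n : Fin r → ℕ) (i : Fin r) : ℕ :=
  n i - if _h : 0 < (i : ℕ) then n ⟨(i : ℕ) - 1, by omega⟩ else 0

/-- The multiple polylogarithm series
`∑_{0<n₁<⋯<n_r} z₁^{n₁} z₂^{n₂-n₁} ⋯ z_r^{n_r-n_{r-1}} / (n₁^{k₁} ⋯ n_r^{k_r})`. -/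
noncomputable def polylogSeries {r : ℕ} (k : Fin r → ℕ) (z : Fin r → ℂ) : ℂ :=
  ∑' n : IncTuple r, ∏ i, z i ^ gap n.1 i / (n.1 i : ℂ) ^ k i

/-- The region `(ℂ ∖ ℝ_{≥1})^r`. It is open, star-shaped about `0`, and contains the open unit
polydisc. -/
def cutRegion (r : ℕ) : Set (Fin r → ℂ) :=
  {z | ∀ j, ∀ x : ℝ, 1 ≤ x → z j ≠ (x : ℂ)}

/-- `L` is holomorphic on `(ℂ ∖ ℝ_{≥1})^r` and is given by the multiple polylogarithm series on the
open unit polydisc. By the identity theorem the values of such an `L` on the region are unique. -/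
structure IsPolylogContinuation {r : ℕ} (k : Fin r → ℕ) (L : (Fin r → ℂ) → ℂ) : Prop where
  differentiableOn : DifferentiableOn ℂ L (cutRegion r)
  eq_series : ∀ z : Fin r → ℂ, (∀ j, ‖z j‖ < 1) → L z = polylogSeries k z

open Classical in
/-- The multiple polylogarithm `Li_{k₁,…,k_r}(z₁,…,z_r)` on `(ℂ ∖ ℝ_{≥1})^r`: the holomorphic
continuation of the series. (For positive integers `k_j` the continuation exists, so the value `0`
in the other branch is not used.) -/
noncomputable def polylog {r : ℕ} (k : Fin r → ℕ) : (Fin r → ℂ) → ℂ :=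
  if h : ∃ L, IsPolylogContinuation k L then h.choose else 0

/-- The open orthant `(0,∞)^r`. -/
def orthant (r : ℕ) : Set (Fin r → ℝ) := {t | ∀ j, 0 < t j}

/-- The point `(1 - e^{t₁+⋯+t_r}, 1 - e^{t₂+⋯+t_r}, …, 1 - e^{t_r})`. -/
noncomputable def etaArg {r : ℕ} (t : Fin r → ℝ) : Fin r → ℂ :=
  fun j => 1 - Complex.exp ((∑ ν ∈ Finset.Ici j, t ν : ℝ) : ℂ)

/-- The integrand
`Li_k(1-e^{t₁+⋯+t_r},…,1-e^{t_r}) / ((1-e^{t₁+⋯+t_r})⋯(1-e^{t_r})) · ∏ t_j^{l_j-1}`,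
for positive integers `k_j`, `l_j`. -/
noncomputable def etaIntegrand {r : ℕ} (k l : Fin r → ℕ) (t : Fin r → ℝ) : ℂ :=
  polylog k (etaArg t) / (∏ j, etaArg t j) * ∏ j, (t j : ℂ) ^ (l j - 1)

/-- The value `η(k₁,…,k_r;l₁,…,l_r)` at positive integers `k_j`, `l_j`. -/
noncomputable def eta {r : ℕ} (k l : Fin r → ℕ) : ℂ :=
  (∏ j, 1 / Complex.Gamma (l j)) * ∫ t in orthant r, etaIntegrand k l t

end EtaMZV

/-!
The exponent `1` in the first slot makes `Li_{1,d+1}` an iterated integral whose inner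
integration is a logarithm:
`Li_{1,d+1}(z₁, z₂) = ∫₀^∞ -log (1 - z₁ e⁻ˣ) · z₂ / (1 - z₂ e⁻ˣ) · x ^ d e⁻ˣ / d! dx`.
The right side is holomorphic on the cut region and equals the series on the polydisc, so it is the
continuation; uniqueness is the identity theorem on complex lines through the origin
(`polylog_eq_polylogIntegral`).

At `z₁ = 1 - e^s`, `z₂ = 1 - e^t` the integrand of `η(1, d+1; 1, e+1)` becomes a positive triple
integral. In terms of `1 - e⁻ˢ`, `1 - e⁻ᵗ` and `1 - e⁻ˣ` it expands as a power series with
nonnegative terms (`hasSum_etaKernel`). Once the elementary integration over `s > t` is done, the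
integrations over `x` and over `t` give differences of the moments
`A_d(n) = ∫₀^∞ (1 - e⁻ˣ) ^ (n - 1) x ^ d e⁻ˣ / d! dx` and of `A_e(n)`, respectively. By parts,
`A_d(n) = (1 / n) ∑_{n ≥ m₁ ≥ ⋯ ≥ m_d ≥ 1} 1 / (m₁ ⋯ m_d)` (`integral_moment`), and one obtains
(`integrableOn_and_eta_eq`)
`η(1, d+1; 1, e+1) = ∑_{m,n ≥ 1} (A_d(n) - A_d(m+n)) (A_e(n) - A_e(m+n)) / m ^ 2`.

Multiplied out, this is a combination of four convergent double series
(`hasSum_momentDiff_mul`). One is a product of two series in nested harmonic sums, the others are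
sums over `N = m + n` of a nested harmonic sum times a convolution with `1 / m ^ 2`. The nested
harmonic sums of given weight span spaces that are closed under pointwise products
(`mul_mem_harmonicSpan`, the stuffle product) and under convolution with `1 / m ^ 2`
(`convBy_inv_sq_mem`, a shuffle product), and the sum over all `N` of a nested harmonic sum whose
last exponent is at least `2` is a multiple zeta value (`summable_and_tsum_mem`).
-/

namespace EtaMZV

open scoped ENNReal Nat Topology
open Filter

/-! ### Nested harmonic sums -/

/-- The sequence `0, 1, 1, 1, …`, the unit for the pointwise product of sequences vanishing at
`0`. -/
noncomputable def posOne : ℕ → ℝ := fun n => if n = 0 then 0 else 1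

/-- Division of a sequence by its index; the value at index `0` is `0`. -/
noncomputable def divIdx : (ℕ → ℝ) →ₗ[ℚ] (ℕ → ℝ) where
  toFun f n := f n / n
  map_add' f g := by ext n; simp [add_div]
  map_smul' c f := by ext n; simp [Rat.smul_def, mul_div_assoc]

/-- The sequence of strict partial sums `n ↦ ∑_{m < n} f m`. -/
noncomputable def partialSum : (ℕ → ℝ) →ₗ[ℚ] (ℕ → ℝ) where
  toFun f n := ∑ m ∈ Finset.range n, f m
  map_add' f g := by ext n; simp [Finset.sum_add_distrib]
  map_smul' c f := by ext n; simp [Finset.smul_sum]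

/-- Convolution by `a`, the product with the power series with coefficients `a`. -/
noncomputable def convBy (a : ℕ → ℝ) : (ℕ → ℝ) →ₗ[ℚ] (ℕ → ℝ) where
  toFun f n := ∑ p ∈ Finset.HasAntidiagonal.antidiagonal n, a p.1 * f p.2
  map_add' f g := by ext n; simp [mul_add, Finset.sum_add_distrib]
  map_smul' c f := by ext n; simp [Finset.smul_sum]

lemma divIdx_apply (f : ℕ → ℝ) (n : ℕ) : divIdx f n = f n / n := rfl
lemma partialSum_apply (f : ℕ → ℝ) (n : ℕ) :
    partialSum f n = ∑ m ∈ Finset.range n, f m := rfl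
lemma convBy_apply (a f : ℕ → ℝ) (n : ℕ) :
    convBy a f n = ∑ p ∈ Finset.HasAntidiagonal.antidiagonal n, a p.1 * f p.2 := rfl

/-- Nested harmonic sums of weight `w`: the sequences obtained from `posOne` by dividing by the
index (which adds `1` to the weight) and taking strict partial sums. The flag tells whether the
last operation was a division; partial sums are only taken after a division. With the flag `true`
these are the sequences `N ↦ ∑_{0<n₁<⋯<n_r=N} 1 / (n₁^{k₁} ⋯ n_r^{k_r})`, with the flag `false` the
same sums over `n_r < N`. -/
inductive HarmonicWord : Bool → ℕ → (ℕ → ℝ) → Prop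
  | unit : HarmonicWord false 0 posOne
  | div {b : Bool} {w : ℕ} {f : ℕ → ℝ} (h : HarmonicWord b w f) :
      HarmonicWord true (w + 1) (divIdx f)
  | sum {w : ℕ} {f : ℕ → ℝ} (h : HarmonicWord true w f) : HarmonicWord false w (partialSum f)

/-- The `ℚ`-span of the nested harmonic sums of weight `w` with a given flag. -/
noncomputable def harmonicSpan (b : Bool) (w : ℕ) : Submodule ℚ (ℕ → ℝ) :=
  Submodule.span ℚ {f | HarmonicWord b w f}

lemma HarmonicWord.mem {b : Bool} {w : ℕ} {f : ℕ → ℝ} (h : HarmonicWord b w f) :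
    f ∈ harmonicSpan b w := Submodule.subset_span h

lemma HarmonicWord.map_zero {b : Bool} {w : ℕ} {f : ℕ → ℝ} (h : HarmonicWord b w f) : f 0 = 0 := by
  cases h <;> simp [posOne, divIdx_apply, partialSum_apply]

lemma HarmonicWord.nonneg {b : Bool} {w : ℕ} {f : ℕ → ℝ} (h : HarmonicWord b w f) (n : ℕ) :
    0 ≤ f n := by
  induction h generalizing n with
  | unit => unfold posOne; split <;> norm_num
  | div _ ih => exact div_nonneg (ih n) n.cast_nonneg
  | sum _ ih => exact Finset.sum_nonneg (s := Finset.range n) fun m _ => ih m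

/-- A linear map sending the words to a submodule sends their span to it. -/
lemma map_mem_of_words {b : Bool} {w : ℕ} (L : (ℕ → ℝ) →ₗ[ℚ] (ℕ → ℝ))
    {V : Submodule ℚ (ℕ → ℝ)} (h : ∀ f, HarmonicWord b w f → L f ∈ V) {f : ℕ → ℝ}
    (hf : f ∈ harmonicSpan b w) : L f ∈ V := by
  have : harmonicSpan b w ≤ V.comap L := Submodule.span_le.2 h
  exact this hf

lemma divIdx_mem {b : Bool} {w : ℕ} {f : ℕ → ℝ} (hf : f ∈ harmonicSpan b w) :
    divIdx f ∈ harmonicSpan true (w + 1) :=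
  map_mem_of_words divIdx (fun _ h => h.div.mem) hf

lemma partialSum_mem {w : ℕ} {f : ℕ → ℝ} (hf : f ∈ harmonicSpan true w) :
    partialSum f ∈ harmonicSpan false w :=
  map_mem_of_words partialSum (fun _ h => h.sum.mem) hf

lemma map_zero_of_mem {b : Bool} {w : ℕ} {f : ℕ → ℝ} (hf : f ∈ harmonicSpan b w) : f 0 = 0 := by
  have : harmonicSpan b w ≤ LinearMap.ker (LinearMap.proj 0) :=
    Submodule.span_le.2 fun g hg => by simpa using HarmonicWord.map_zero hg
  simpa using this hf

/-! ### Pointwise products -/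

lemma divIdx_mul (f g : ℕ → ℝ) : divIdx f * g = divIdx (f * g) := by
  ext n; simp only [Pi.mul_apply, divIdx_apply]; ring

lemma posOne_mul {f : ℕ → ℝ} (h : f 0 = 0) : posOne * f = f := by
  ext n; by_cases hn : n = 0 <;> simp [posOne, hn, h]

/-- Two strict partial sums multiply by comparing the two summation indices. -/
lemma partialSum_mul_partialSum (f g : ℕ → ℝ) :
    partialSum f * partialSum g = partialSum (f * partialSum g + partialSum f * g + f * g) := by
  ext n
  simp only [Pi.mul_apply, partialSum_apply, Pi.add_apply]
  induction n with
  | zero => simp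
  | succ n ih => simp only [Finset.sum_range_succ, ← ih]; ring

lemma HarmonicWord.mul_mem (n : ℕ) : ∀ {b b' : Bool} {w w' : ℕ} {f g : ℕ → ℝ}, w + w' = n →
    HarmonicWord b w f → HarmonicWord b' w' g → f * g ∈ harmonicSpan (b || b') n := by
  induction n using Nat.strong_induction_on with
  | _ n ih =>
  have key : ∀ {b' : Bool} {w w' : ℕ} {f g : ℕ → ℝ}, w + w' = n →
      HarmonicWord true w f → HarmonicWord b' w' g → f * g ∈ harmonicSpan true n := by
    intro b' w w' f g hn hf hg
    cases hf with
    | @div b w f hf =>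
      obtain ⟨m, rfl⟩ : ∃ m, n = m + 1 := ⟨w + w', by omega⟩
      rw [divIdx_mul]
      exact divIdx_mem (ih m (by omega) (by omega) hf hg)
  intro b b' w w' f g hn hf hg
  cases b with
  | true => exact key hn hf hg
  | false =>
    cases b' with
    | true => rw [mul_comm]; exact key (by omega) hg hf
    | false =>
      cases hf with
      | unit =>
        rw [posOne_mul hg.map_zero]
        obtain rfl : w' = n := by omega
        exact hg.mem
      | sum hf =>
        cases hg with
        | unit =>
          rw [mul_comm, posOne_mul hf.sum.map_zero]
          obtain rfl : w = n := by omega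
          exact hf.sum.mem
        | sum hg =>
          rw [partialSum_mul_partialSum]
          refine partialSum_mem (add_mem (add_mem (key hn hf hg.sum) ?_) (key hn hf hg))
          rw [mul_comm]
          exact key (by omega) hg hf.sum

/-- Spans of nested harmonic sums multiply, weights being added. -/
lemma mul_mem_harmonicSpan {b b' : Bool} {w w' : ℕ} {f g : ℕ → ℝ} (hf : f ∈ harmonicSpan b w)
    (hg : g ∈ harmonicSpan b' w') : f * g ∈ harmonicSpan (b || b') (w + w') := by
  have : harmonicSpan b w * harmonicSpan b' w' ≤ harmonicSpan (b || b') (w + w') := by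
    unfold harmonicSpan
    rw [Submodule.span_mul_span, Submodule.span_le]
    rintro _ ⟨f, hf, g, hg, rfl⟩
    exact HarmonicWord.mul_mem _ rfl hf hg
  exact this (Submodule.mul_mem_mul hf hg)

/-! ### Convolution -/

lemma convBy_comm (a f : ℕ → ℝ) : convBy a f = convBy f a := by
  ext n
  rw [convBy_apply, convBy_apply, ← Finset.Nat.sum_antidiagonal_swap]
  exact Finset.sum_congr rfl fun p _ => mul_comm _ _

lemma convBy_partialSum (a f : ℕ → ℝ) : convBy a (partialSum f) = partialSum (convBy a f) := by
  ext n
  rw [partialSum_apply]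
  induction n with
  | zero => simp [convBy_apply, partialSum_apply]
  | succ n ih =>
    rw [Finset.sum_range_succ, ← ih, convBy_apply, Finset.Nat.sum_antidiagonal_succ']
    simp only [convBy_apply, partialSum_apply, Finset.sum_range_succ, mul_add,
      Finset.sum_add_distrib]
    simp

lemma convBy_posOne (a : ℕ → ℝ) : convBy a posOne = partialSum a := by
  ext n
  rw [convBy_apply, Finset.Nat.sum_antidiagonal_eq_sum_range_succ (fun i j => a i * posOne j),
    Finset.sum_range_succ, partialSum_apply]
  simp only [posOne, Nat.sub_self, if_true, mul_zero, add_zero]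
  refine Finset.sum_congr rfl fun m hm => ?_
  have := Finset.mem_range.1 hm
  rw [if_neg (by omega), mul_one]

/-- The Leibniz rule for multiplication by the index, which is the derivation `x d/dx` on power
series. -/
lemma convBy_divIdx_divIdx {a f : ℕ → ℝ} (ha : a 0 = 0) (hf : f 0 = 0) :
    convBy (divIdx a) (divIdx f) = divIdx (convBy a (divIdx f) + convBy (divIdx a) f) := by
  ext n
  rcases Nat.eq_zero_or_pos n with rfl | hn
  · simp [convBy_apply, divIdx_apply]
  rw [divIdx_apply, eq_div_iff (by positivity), Pi.add_apply, convBy_apply, convBy_apply,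
    convBy_apply, Finset.sum_mul, ← Finset.sum_add_distrib]
  refine Finset.sum_congr rfl fun p hp => ?_
  have hp : p.1 + p.2 = n := by simpa using hp
  rcases Nat.eq_zero_or_pos p.1 with h1 | h1
  · simp [divIdx_apply, h1, ha]
  rcases Nat.eq_zero_or_pos p.2 with h2 | h2
  · simp [divIdx_apply, h2, hf]
  simp only [divIdx_apply]
  rw [← hp]
  push_cast
  field_simp

/-- If convolution by `a` adds `j` to the weight, convolution by `a n / n` adds `j + 1`: this is the
recursion defining the shuffle product of iterated integrals. -/
lemma convBy_divIdx_mem {a : ℕ → ℝ} {b : Bool} {j : ℕ} (ha : a ∈ harmonicSpan b j)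
    (h : ∀ w f, HarmonicWord true w f → ∃ c, convBy a f ∈ harmonicSpan c (w + j))
    {c : Bool} {w : ℕ} {f : ℕ → ℝ} (hf : f ∈ harmonicSpan c w) :
    convBy (divIdx a) f ∈ harmonicSpan c (w + (j + 1)) := by
  refine map_mem_of_words _ (fun g hg => ?_) hf
  clear hf f
  induction hg with
  | unit => rw [convBy_posOne, zero_add]; exact partialSum_mem (divIdx_mem ha)
  | @div b w f hf ih =>
    rw [convBy_divIdx_divIdx (map_zero_of_mem ha) hf.map_zero, map_add]
    refine add_mem ?_ ?_
    · obtain ⟨c, hc⟩ := h _ _ hf.div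
      exact divIdx_mem hc
    · have := divIdx_mem ih
      rwa [add_right_comm] at this
  | sum hf ih => rw [convBy_partialSum]; exact partialSum_mem ih

/-- Convolution by the sequence `1 / n ^ 2` adds `2` to the weight. -/
lemma convBy_inv_sq_mem {b : Bool} {w : ℕ} {f : ℕ → ℝ} (hf : f ∈ harmonicSpan b w) :
    convBy (divIdx (divIdx posOne)) f ∈ harmonicSpan b (w + 2) := by
  have h1 : ∀ {c : Bool} {w : ℕ} {f : ℕ → ℝ}, f ∈ harmonicSpan c w →
      convBy (divIdx posOne) f ∈ harmonicSpan c (w + 1) :=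
    convBy_divIdx_mem HarmonicWord.unit.mem fun w f hf =>
      ⟨false, by rw [convBy_comm, convBy_posOne]; exact partialSum_mem hf.mem⟩
  exact convBy_divIdx_mem HarmonicWord.unit.div.mem (fun w f hf => ⟨true, h1 hf.mem⟩) hf

/-! ### Infinite sums of nested harmonic sums -/

/-- Splitting off the last entry of an increasing tuple. -/
def incTupleSuccEquiv (r : ℕ) :
    IncTuple (r + 2) ≃ Σ n : IncTuple (r + 1), {N : ℕ // n.1 (Fin.last r) < N} where
  toFun n := ⟨⟨Fin.init n.1, fun _ _ h => n.2.1 (Fin.castSucc_lt_castSucc_iff.2 h),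
    fun i => n.2.2 i.castSucc⟩, ⟨n.1 (Fin.last _), n.2.1 (Fin.castSucc_lt_last _)⟩⟩
  invFun p := ⟨Fin.snoc (α := fun _ => ℕ) p.1.1 p.2.1, by
    refine ⟨Fin.strictMono_iff_lt_succ.2 fun i => ?_, fun i => ?_⟩
    · induction i using Fin.lastCases with
      | last =>
        rw [Fin.succ_last, Fin.snoc_last, Fin.snoc_castSucc]
        exact p.2.2
      | cast i =>
        rw [← Fin.castSucc_succ, Fin.snoc_castSucc, Fin.snoc_castSucc]
        exact p.1.2.1 Fin.castSucc_lt_succ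
    · induction i using Fin.lastCases with
      | last => rw [Fin.snoc_last]; exact (Nat.zero_le _).trans_lt p.2.2
      | cast i => rw [Fin.snoc_castSucc]; exact p.1.2.2 i⟩
  left_inv n := Subtype.ext (Fin.snoc_init_self n.1)
  right_inv p := by
    obtain ⟨⟨n, hn⟩, N, hN⟩ := p
    refine Sigma.subtype_ext (Subtype.ext ?_) ?_
    · exact Fin.init_snoc (α := fun _ => ℕ) N n
    · exact Fin.snoc_last (α := fun _ => ℕ) N n

/-- The summand of a multiple zeta value as an extended nonnegative real. -/
noncomputable def mzvTerm {r : ℕ} (k : Fin r → ℕ) (n : Fin r → ℕ) : ℝ≥0∞ :=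
  ∏ i, ENNReal.ofReal (1 / (n i : ℝ) ^ k i)

/-- `f` is the sequence of sums `∑ 1 / (n₁^{k₁} ⋯ n_r^{k_r})` over `0 < n₁ < ⋯ < n_r = N`, for some
positive `k₁, …, k_r` of sum `w` and some `r > 0`. This is expressed by summing against an
arbitrary weight function of `n_r`. -/
def IsFiberSum (w : ℕ) (f : ℕ → ℝ) : Prop :=
  ∃ (r : ℕ) (k : Fin (r + 1) → ℕ), (∀ i, 0 < k i) ∧ ∑ i, k i = w ∧ ∀ g : ℕ → ℝ≥0∞,
    ∑' N, ENNReal.ofReal (f N) * g N =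
      ∑' n : IncTuple (r + 1), mzvTerm k n.1 * g (n.1 (Fin.last r))

lemma mzvTerm_update_last {r : ℕ} (k n : Fin (r + 1) → ℕ) :
    mzvTerm (Fin.snoc (α := fun _ => ℕ) (Fin.init k) (k (Fin.last r) + 1)) n =
      mzvTerm k n * ENNReal.ofReal (1 / n (Fin.last r)) := by
  simp only [mzvTerm, Fin.prod_univ_castSucc, Fin.snoc_castSucc, Fin.snoc_last, Fin.init, mul_assoc]
  rw [← ENNReal.ofReal_mul (by positivity), pow_succ, one_div_mul_one_div]

lemma ofReal_divIdx (f : ℕ → ℝ) (n : ℕ) :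
    ENNReal.ofReal (divIdx f n) = ENNReal.ofReal (f n) * ENNReal.ofReal (1 / n) := by
  rw [divIdx_apply, div_eq_mul_one_div, ENNReal.ofReal_mul' (by positivity)]

lemma IsFiberSum.divIdx {w : ℕ} {f : ℕ → ℝ} (h : IsFiberSum w f) :
    IsFiberSum (w + 1) (divIdx f) := by
  obtain ⟨r, k, hk, hw, hs⟩ := h
  refine ⟨r, Fin.snoc (α := fun _ => ℕ) (Fin.init k) (k (Fin.last r) + 1), fun i => ?_, ?_,
    fun g => ?_⟩
  · induction i using Fin.lastCases with
    | last => simp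
    | cast i => simpa [Fin.init] using hk _
  · rw [← hw, Fin.sum_univ_castSucc, Fin.sum_univ_castSucc]
    simp [Fin.init, add_assoc]
  · simp only [ofReal_divIdx, mzvTerm_update_last, mul_assoc]
    exact hs fun N => ENNReal.ofReal (1 / N) * g N

lemma isFiberSum_divIdx_posOne : IsFiberSum 1 (divIdx posOne) := by
  refine ⟨0, fun _ => 1, fun _ => one_pos, by simp, fun g => ?_⟩
  let e : IncTuple 1 ≃ {N : ℕ // 0 < N} :=
    { toFun := fun n => ⟨n.1 0, n.2.2 0⟩
      invFun := fun N => ⟨fun _ => N.1, Subsingleton.strictMono _, fun _ => N.2⟩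
      left_inv := fun n => Subtype.ext (funext fun i => by rw [Subsingleton.elim i 0])
      right_inv := fun N => rfl }
  rw [← e.symm.tsum_eq]
  refine Eq.trans ?_ (tsum_subtype {N : ℕ | 0 < N} fun N : ℕ =>
    mzvTerm (r := 1) (fun _ => 1) (fun _ => N) * g N).symm
  refine tsum_congr fun N => ?_
  rcases Nat.eq_zero_or_pos N with rfl | hN
  · simp [divIdx_apply]
  · rw [Set.indicator_of_mem (by exact hN)]
    simp [divIdx_apply, posOne, mzvTerm, hN.ne']

lemma IsFiberSum.divIdx_partialSum {w : ℕ} {f : ℕ → ℝ} (h : IsFiberSum w f) (hf : ∀ n, 0 ≤ f n) :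
    IsFiberSum (w + 1) (EtaMZV.divIdx (partialSum f)) := by
  obtain ⟨r, k, hk, hw, hs⟩ := h
  refine ⟨r + 1, Fin.snoc (α := fun _ => ℕ) k 1, fun i => ?_, ?_, fun g => ?_⟩
  · induction i using Fin.lastCases with
    | last => simp
    | cast i => simpa using hk _
  · rw [← hw, Fin.sum_univ_castSucc]
    simp
  · set G : ℕ → ℕ → ℝ≥0∞ := fun M =>
      Set.indicator {N | M < N} fun N => ENNReal.ofReal (1 / N) * g N with hG
    have lhs : ∑' N, ENNReal.ofReal (EtaMZV.divIdx (partialSum f) N) * g N =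
        ∑' M, ENNReal.ofReal (f M) * ∑' N, G M N := by
      simp only [← ENNReal.tsum_mul_left]
      rw [ENNReal.tsum_comm]
      refine tsum_congr fun N => ?_
      rw [tsum_eq_sum (s := Finset.range N), ofReal_divIdx, partialSum_apply,
        ENNReal.ofReal_sum_of_nonneg fun m _ => hf m, mul_assoc, Finset.sum_mul]
      · refine Finset.sum_congr rfl fun M hM => ?_
        simp only [hG]
        rw [Set.indicator_of_mem (by exact Finset.mem_range.1 hM)]
      · intro M hM
        simp only [hG]
        rw [Set.indicator_of_notMem (by exact fun h => hM (Finset.mem_range.2 h)), mul_zero]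
    rw [lhs, hs, ← (incTupleSuccEquiv r).symm.tsum_eq]
    refine Eq.trans ?_ (ENNReal.tsum_sigma' _).symm
    refine tsum_congr fun n => ?_
    simp only [hG]
    rw [← tsum_subtype, ← ENNReal.tsum_mul_left]
    refine tsum_congr fun N => ?_
    rw [← mul_assoc]
    congr 1
    · simp [incTupleSuccEquiv, mzvTerm, Fin.prod_univ_castSucc]
    · simp [incTupleSuccEquiv]

lemma HarmonicWord.isFiberSum {w : ℕ} {f : ℕ → ℝ} (h : HarmonicWord true w f) :
    IsFiberSum w f := by
  suffices ∀ b w f, HarmonicWord b w f →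
      (b = true → IsFiberSum w f) ∧ (b = false → IsFiberSum (w + 1) (EtaMZV.divIdx f)) from
    (this _ _ _ h).1 rfl
  intro b w f h
  induction h with
  | unit => simpa using isFiberSum_divIdx_posOne
  | @div b w f h ih =>
    cases b
    · simpa using ih.2
    · simpa using (ih.1 rfl).divIdx
  | sum h ih => simpa using (ih.1 rfl).divIdx_partialSum h.nonneg

/-- One more division by the index makes the last exponent greater than `1`, so that the sum of the
whole sequence is a multiple zeta value. -/
lemma HarmonicWord.tsum_divIdx_mem {w : ℕ} {f : ℕ → ℝ} (h : HarmonicWord true w f) :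
    ∑' N, EtaMZV.divIdx f N ∈ mzvSpan (w + 1) := by
  obtain ⟨r, k, hk, hw, hs⟩ := h.isFiberSum
  refine Submodule.subset_span
    ⟨r + 1, Fin.snoc (α := fun _ => ℕ) (Fin.init k) (k (Fin.last r) + 1), ⟨fun i => ?_, ?_⟩, ?_, ?_⟩
  · induction i using Fin.lastCases with
    | last => simp
    | cast i => simpa [Fin.init] using hk _
  · intro i hi
    obtain rfl : i = Fin.last r := Fin.ext (by simpa using hi)
    simpa using hk _
  · rw [← hw, Fin.sum_univ_castSucc, Fin.sum_univ_castSucc]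
    simp [Fin.init, add_assoc]
  · have e := congrArg ENNReal.toReal (hs fun N => ENNReal.ofReal (1 / N))
    simp only [← ofReal_divIdx, ← mzvTerm_update_last] at e
    simp only [mzvTerm] at e
    rw [ENNReal.tsum_toReal_eq fun _ => ENNReal.ofReal_ne_top, ENNReal.tsum_toReal_eq
      fun n => ENNReal.prod_ne_top fun _ _ => ENNReal.ofReal_ne_top] at e
    simp only [ENNReal.toReal_ofReal (h.div.nonneg _), ENNReal.toReal_prod] at e
    rw [e, mzv]
    refine tsum_congr fun n => Finset.prod_congr rfl fun i _ => ?_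
    rw [ENNReal.toReal_ofReal (by positivity)]

/-- A crude growth bound for nested harmonic sums, enough for convergence after one more division
by the index. -/
lemma HarmonicWord.exists_bound {w : ℕ} {f : ℕ → ℝ} (h : HarmonicWord true w f) :
    ∃ C : ℝ, ∀ n, f n * √n ≤ C := by
  suffices ∀ b w f, HarmonicWord b w f →
      ∃ C : ℝ, 0 ≤ C ∧ ∀ n : ℕ, if b then f n * √n ≤ C else f n ≤ C * √n by
    obtain ⟨C, -, hC⟩ := this _ _ _ h
    exact ⟨C, by simpa using hC⟩
  intro b w f h
  induction h with
  | unit =>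
    refine ⟨1, zero_le_one, fun n => ?_⟩
    rcases Nat.eq_zero_or_pos n with rfl | hn
    · simp [posOne]
    · simpa [posOne, hn.ne'] using Nat.succ_le_of_lt hn
  | @div b w f h ih =>
    obtain ⟨C, hC, ih⟩ := ih
    refine ⟨C, hC, fun n => ?_⟩
    rcases Nat.eq_zero_or_pos n with rfl | hn
    · simpa [divIdx_apply] using hC
    have hn' : (1 : ℝ) ≤ n := by exact_mod_cast hn
    have := ih n
    cases b
    · simp only [Bool.false_eq_true, if_false] at this
      simp only [if_true, divIdx_apply]
      rw [div_mul_eq_mul_div, div_le_iff₀ (by positivity)]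
      calc f n * √n ≤ C * √n * √n := by gcongr
        _ = C * n := by rw [mul_assoc, Real.mul_self_sqrt (by positivity)]
    · simp only [if_true, divIdx_apply] at this ⊢
      rw [div_mul_eq_mul_div, div_le_iff₀ (by positivity)]
      nlinarith
  | @sum w f h ih =>
    obtain ⟨C, hC, ih⟩ := ih
    refine ⟨3 * C, by positivity, fun n => ?_⟩
    simp only [Bool.false_eq_true, if_false, if_true] at ih ⊢
    rw [partialSum_apply]
    induction n with
    | zero => simp
    | succ n hn =>
      rw [Finset.sum_range_succ]
      rcases Nat.eq_zero_or_pos n with rfl | hpos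
      · simp [h.map_zero, hC]
      have hn1 : (1 : ℝ) ≤ n := by exact_mod_cast hpos
      have h1 : 0 < √(n : ℝ) := Real.sqrt_pos.2 (by linarith)
      have h2 : √(n : ℝ) ^ 2 = n := Real.sq_sqrt (by linarith)
      have h3 : √((n + 1 : ℕ) : ℝ) ^ 2 = n + 1 := by
        rw [Real.sq_sqrt (by positivity)]; push_cast; rfl
      have h4 : 0 ≤ √((n + 1 : ℕ) : ℝ) := Real.sqrt_nonneg _
      have h5 := ih n
      set a := √(n : ℝ)
      set b := √((n + 1 : ℕ) : ℝ)
      have h6 : b ≤ 2 * a := by nlinarith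
      have h7 : a ≤ b := by nlinarith
      -- `(b - a) (b + a) = 1` and `b + a ≤ 3 a`
      have h8 : 1 ≤ 3 * a * (b - a) := by nlinarith
      have h9 : f n ≤ 3 * C * (b - a) := by
        refine le_of_mul_le_mul_right ?_ h1
        nlinarith
      linarith

lemma HarmonicWord.summable_divIdx {w : ℕ} {f : ℕ → ℝ} (h : HarmonicWord true w f) :
    Summable (EtaMZV.divIdx f) := by
  obtain ⟨C, hC⟩ := h.exists_bound
  have hs : Summable fun n : ℕ => C * (1 / (n : ℝ) ^ (3 / 2 : ℝ)) :=
    (Real.summable_one_div_nat_rpow.2 (by norm_num)).mul_left C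
  refine Summable.of_nonneg_of_le h.div.nonneg (fun n => ?_) hs
  rcases Nat.eq_zero_or_pos n with rfl | hn
  · simp [divIdx_apply]
  have hn' : (0 : ℝ) < n := by exact_mod_cast hn
  have e : (n : ℝ) ^ (3 / 2 : ℝ) = √n * n := by
    rw [Real.sqrt_eq_rpow, ← Real.rpow_add_one hn'.ne']; norm_num
  rw [divIdx_apply, e, mul_one_div, div_le_div_iff₀ hn' (by positivity)]
  nlinarith [hC n]

/-- The `ℚ`-span of the sequences `f n / n`, where `f` is a nested harmonic sum of weight `w` with
`n_r = n`; these sequences are summable. -/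
noncomputable def summableSpan (w : ℕ) : Submodule ℚ (ℕ → ℝ) :=
  (harmonicSpan true w).map divIdx

lemma summable_and_tsum_mem {w : ℕ} {f : ℕ → ℝ} (hf : f ∈ summableSpan w) :
    Summable f ∧ ∑' n, f n ∈ mzvSpan (w + 1) := by
  obtain ⟨f, hf, rfl⟩ := hf
  induction hf using Submodule.span_induction with
  | mem f hf => exact ⟨HarmonicWord.summable_divIdx hf, HarmonicWord.tsum_divIdx_mem hf⟩
  | zero => rw [map_zero]; exact ⟨summable_zero, by simp⟩
  | add f g _ _ hf hg =>
    rw [map_add]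
    refine ⟨hf.1.add hg.1, ?_⟩
    simp only [Pi.add_apply]
    rw [hf.1.tsum_add hg.1]
    exact add_mem hf.2 hg.2
  | smul c f _ hf =>
    rw [map_smul]
    refine ⟨hf.1.const_smul c, ?_⟩
    simp only [Pi.smul_apply]
    rw [hf.1.tsum_const_smul]
    exact Submodule.smul_mem _ _ hf.2

lemma summableSpan_le (w : ℕ) : summableSpan w ≤ harmonicSpan true (w + 1) := by
  rintro _ ⟨f, hf, rfl⟩
  exact divIdx_mem hf

lemma divIdx_mul_mem_summableSpan {b b' : Bool} {w w' : ℕ} {f g : ℕ → ℝ}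
    (hb : (b || b') = true) (hf : f ∈ harmonicSpan b w) (hg : g ∈ harmonicSpan b' w') :
    divIdx f * g ∈ summableSpan (w + w') := by
  rw [divIdx_mul]
  exact ⟨_, hb ▸ mul_mem_harmonicSpan hf hg, rfl⟩

/-! ### The double polylogarithm as an integral -/

lemma hasSum_of_eq {ι E : Type*} [AddCommMonoid E] [TopologicalSpace E] {f g : ι → E} {a : E}
    (h : HasSum f a) (e : ∀ i, f i = g i) : HasSum g a := funext e ▸ h

/-- Termwise integration of a series with summable `L¹` norms. -/
lemma integrable_and_hasSum_integral {α E ι : Type*} [MeasurableSpace α] {μ : Measure α}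
    [NormedAddCommGroup E] [NormedSpace ℝ E] [Countable ι] {F : ι → α → E} {f : α → E}
    (hF : ∀ i, Integrable (F i) μ) (hs : Summable fun i => ∫ a, ‖F i a‖ ∂μ)
    (hf : ∀ᵐ a ∂μ, HasSum (fun i => F i a) (f a)) :
    Integrable f μ ∧ HasSum (fun i => ∫ a, F i a ∂μ) (∫ a, f a ∂μ) := by
  refine ⟨⟨?_, ?_⟩, ?_⟩
  · refine aestronglyMeasurable_of_tendsto_ae (u := (atTop : Filter (Finset ι)))
      (f := fun s a => ∑ i ∈ s, F i a) (fun s => ?_) hf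
    exact Finset.aestronglyMeasurable_fun_sum s fun i _ => (hF i).1
  · have h1 : ∫⁻ a, ‖f a‖ₑ ∂μ ≤ ∫⁻ a, ∑' i, ‖F i a‖ₑ ∂μ := by
      refine lintegral_mono_ae (hf.mono fun a ha => ?_)
      rw [← ha.tsum_eq]
      exact enorm_tsum_le_tsum_enorm
    refine h1.trans_lt ?_
    rw [lintegral_tsum fun i => (hF i).1.enorm]
    have h2 : ∀ i, ∫⁻ a, ‖F i a‖ₑ ∂μ = ENNReal.ofReal (∫ a, ‖F i a‖ ∂μ) := fun i => by
      rw [ofReal_integral_norm_eq_lintegral_enorm (hF i)]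
    simp only [h2]
    rw [← ENNReal.ofReal_tsum_of_nonneg (fun i => integral_nonneg fun a => norm_nonneg _) hs]
    exact ENNReal.ofReal_lt_top
  · have := hasSum_integral_of_summable_integral_norm hF hs
    rwa [integral_congr_ae (hf.mono fun a ha => ha.tsum_eq)] at this

/-- The probability density `x ^ d e⁻ˣ / d!` on `(0, ∞)`. -/
noncomputable def gammaWeight (d : ℕ) (x : ℝ) : ℝ := Real.exp (-x) * x ^ d / d !

lemma gammaWeight_nonneg (d : ℕ) {x : ℝ} (hx : x ∈ Set.Ioi (0 : ℝ)) : 0 ≤ gammaWeight d x :=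
  div_nonneg (mul_nonneg (Real.exp_pos _).le (pow_nonneg (le_of_lt hx) _)) (Nat.cast_nonneg _)

lemma continuous_gammaWeight (d : ℕ) : Continuous (gammaWeight d) := by
  unfold gammaWeight; fun_prop

lemma integrableOn_gammaWeight (d : ℕ) : IntegrableOn (gammaWeight d) (Set.Ioi 0) := by
  have := (Real.GammaIntegral_convergent (s := d + 1) (by positivity)).div_const (d ! : ℝ)
  refine IntegrableOn.congr_fun this (fun x _ => ?_) measurableSet_Ioi
  simp [gammaWeight]

lemma integral_exp_mul_gammaWeight (d n : ℕ) :
    ∫ x in Set.Ioi (0 : ℝ), Real.exp (-x) ^ n * gammaWeight d x = 1 / ((n : ℝ) + 1) ^ (d + 1) := by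
  have h := Real.integral_rpow_mul_exp_neg_mul_Ioi (a := d + 1) (r := n + 1)
    (by positivity) (by positivity)
  rw [Real.Gamma_nat_eq_factorial] at h
  have h2 : ∫ x in Set.Ioi (0 : ℝ), Real.exp (-x) ^ n * gammaWeight d x =
      (∫ x in Set.Ioi (0 : ℝ), x ^ ((d : ℝ) + 1 - 1) * Real.exp (-((n + 1) * x))) / d ! := by
    rw [← integral_div]
    refine setIntegral_congr_fun measurableSet_Ioi fun x _ => ?_
    simp only [gammaWeight, add_sub_cancel_right, Real.rpow_natCast, ← Real.exp_nat_mul]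
    rw [show -((n + 1) * x) = n * (-x) + -x by ring, Real.exp_add]
    ring
  rw [h2, h, mul_div_assoc, div_self (by positivity), mul_one, ← Nat.cast_add_one d,
    Real.rpow_natCast, div_pow, one_pow]

lemma exp_neg_mem_Icc {x : ℝ} (hx : x ∈ Set.Ioi (0 : ℝ)) : Real.exp (-x) ∈ Set.Icc (0 : ℝ) 1 :=
  ⟨(Real.exp_pos _).le, Real.exp_le_one_iff.2 (by simpa using le_of_lt hx)⟩

/-- A bounded continuous function times `gammaWeight` is integrable. -/
lemma integrableOn_smul_gammaWeight {E : Type*} [NormedAddCommGroup E] [NormedSpace ℝ E] (d : ℕ)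
    {q : ℝ → E} {C : ℝ} (hq : ContinuousOn q (Set.Ioi 0)) (hC : ∀ x ∈ Set.Ioi (0 : ℝ), ‖q x‖ ≤ C) :
    IntegrableOn (fun x => gammaWeight d x • q x) (Set.Ioi 0) := by
  refine ((integrableOn_gammaWeight d).mul_const C).mono'
    (((continuous_gammaWeight d).continuousOn.smul hq).aestronglyMeasurable measurableSet_Ioi)
    ((ae_restrict_iff' measurableSet_Ioi).2 (Eventually.of_forall fun x hx => ?_))
  rw [norm_smul, Real.norm_of_nonneg (gammaWeight_nonneg d hx)]
  exact mul_le_mul_of_nonneg_left (hC x hx) (gammaWeight_nonneg d hx)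

/-- The integrand `-log (1 - z₁ u) · z₂ / (1 - z₂ u)` of the last two integrations in the iterated
integral for the double polylogarithm. -/
noncomputable def polylogKernel (z : Fin 2 → ℂ) (u : ℂ) : ℂ :=
  -Complex.log (1 - z 0 * u) * (z 1 / (1 - z 1 * u))

/-- The function `Li_{1,d+1}(z₁, z₂)` as the integral of `polylogKernel z (e⁻ˣ)` against
`x ^ d e⁻ˣ / d!`. -/
noncomputable def polylogIntegral (d : ℕ) (z : Fin 2 → ℂ) : ℂ :=
  ∫ x in Set.Ioi (0 : ℝ), gammaWeight d x • polylogKernel z (Real.exp (-x) : ℂ)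

lemma one_sub_mem_slitPlane {z : ℂ} (hz : ∀ x : ℝ, 1 ≤ x → z ≠ x) {u : ℝ}
    (hu : u ∈ Set.Icc (0 : ℝ) 1) : 1 - z * u ∈ Complex.slitPlane := by
  by_contra h
  rw [Complex.mem_slitPlane_iff] at h
  push Not at h
  obtain ⟨h1, h2⟩ := h
  simp only [Complex.sub_re, Complex.one_re, Complex.mul_re, Complex.ofReal_re, Complex.ofReal_im,
    mul_zero, sub_zero, Complex.sub_im, Complex.one_im, Complex.mul_im, zero_sub, zero_add,
    neg_eq_zero] at h1 h2
  have hu0 : u ≠ 0 := by rintro rfl; norm_num at h1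
  have him : z.im = 0 := by simpa [hu0] using h2
  have hpos : 0 < u := lt_of_le_of_ne hu.1 hu0.symm
  refine hz z.re ?_ (Complex.ext rfl (by simpa using him))
  nlinarith [hu.2]

lemma isOpen_cutRegion (r : ℕ) : IsOpen (cutRegion r) := by
  have h : cutRegion r = ⋂ j, (fun z : Fin r → ℂ => z j) ⁻¹' (Complex.ofReal '' Set.Ici 1)ᶜ := by
    ext z
    simp only [cutRegion, Set.mem_ofPred_eq, Set.mem_iInter, Set.mem_preimage, Set.mem_compl_iff,
      Set.mem_image, Set.mem_Ici, not_exists, not_and]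
    exact forall_congr' fun j => forall_congr' fun x => imp_congr_right fun _ => ne_comm
  rw [h]
  refine isOpen_iInter_of_finite fun j => IsOpen.preimage (continuous_apply j) ?_
  exact (Complex.isometry_ofReal.isClosedEmbedding.isClosedMap _ isClosed_Ici).isOpen_compl

/-- The pairs `(z, u)` at which the kernel is holomorphic. -/
def kernelDomain : Set ((Fin 2 → ℂ) × ℂ) :=
  {p | 1 - p.1 0 * p.2 ∈ Complex.slitPlane ∧ 1 - p.1 1 * p.2 ∈ Complex.slitPlane}

lemma mem_kernelDomain {z : Fin 2 → ℂ} (hz : z ∈ cutRegion 2) {u : ℝ} (hu : u ∈ Set.Icc (0 : ℝ) 1) :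
    (z, (u : ℂ)) ∈ kernelDomain :=
  ⟨one_sub_mem_slitPlane (hz 0) hu, one_sub_mem_slitPlane (hz 1) hu⟩

lemma continuousOn_polylogKernel :
    ContinuousOn (fun p : (Fin 2 → ℂ) × ℂ => polylogKernel p.1 p.2) kernelDomain := by
  unfold polylogKernel
  exact ContinuousOn.mul (ContinuousOn.neg (ContinuousOn.clog (by fun_prop) fun p hp => hp.1))
    (ContinuousOn.div (by fun_prop) (by fun_prop) fun p hp => Complex.slitPlane_ne_zero hp.2)

/-- The derivative of the kernel in `z`. -/
noncomputable def polylogKernelDeriv (p : (Fin 2 → ℂ) × ℂ) : (Fin 2 → ℂ) →L[ℂ] ℂ :=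
  (p.2 * (1 - p.1 0 * p.2)⁻¹ * (p.1 1 / (1 - p.1 1 * p.2))) • ContinuousLinearMap.proj 0 +
    (-Complex.log (1 - p.1 0 * p.2) * ((1 - p.1 1 * p.2) ^ 2)⁻¹) • ContinuousLinearMap.proj 1

lemma hasFDerivAt_polylogKernel {z : Fin 2 → ℂ} {u : ℂ} (h : (z, u) ∈ kernelDomain) :
    HasFDerivAt (fun z => polylogKernel z u) (polylogKernelDeriv (z, u)) z := by
  have h0 := (ContinuousLinearMap.proj (R := ℂ) 0).hasFDerivAt (x := z)
  have h1 := (ContinuousLinearMap.proj (R := ℂ) 1).hasFDerivAt (x := z)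
  have hne0 := Complex.slitPlane_ne_zero h.1
  have hne1 := Complex.slitPlane_ne_zero h.2
  have hA := (((h0.mul_const u).const_sub 1).clog h.1).neg
  have hB := h1.mul ((hasDerivAt_inv hne1).comp_hasFDerivAt z ((h1.mul_const u).const_sub 1))
  refine (hA.mul hB).congr_fderiv ?_
  ext i
  simp [polylogKernelDeriv] at hne0 hne1 ⊢
  field_simp
  ring

lemma continuousOn_polylogKernelDeriv : ContinuousOn polylogKernelDeriv kernelDomain := by
  unfold polylogKernelDeriv
  refine ContinuousOn.fun_add (ContinuousOn.fun_smul ?_ continuousOn_const)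
    (ContinuousOn.fun_smul ?_ continuousOn_const)
  · refine ContinuousOn.mul (ContinuousOn.mul (by fun_prop) (ContinuousOn.inv₀ (by fun_prop) ?_))
      (ContinuousOn.div (by fun_prop) (by fun_prop) ?_)
    · exact fun p hp => Complex.slitPlane_ne_zero hp.1
    · exact fun p hp => Complex.slitPlane_ne_zero hp.2
  · refine ContinuousOn.mul (ContinuousOn.neg (ContinuousOn.clog (by fun_prop) fun p hp => hp.1))
      (ContinuousOn.inv₀ (by fun_prop) fun p hp => pow_ne_zero _ (Complex.slitPlane_ne_zero hp.2))

lemma continuousOn_exp_kernel {E : Type*} [TopologicalSpace E] {q : (Fin 2 → ℂ) × ℂ → E}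
    (hq : ContinuousOn q kernelDomain) {z : Fin 2 → ℂ} (hz : z ∈ cutRegion 2) :
    ContinuousOn (fun x : ℝ => q (z, (Real.exp (-x) : ℂ))) (Set.Ioi 0) :=
  hq.comp (by fun_prop) fun _ hx => mem_kernelDomain hz (exp_neg_mem_Icc hx)

lemma exists_kernel_bound {E : Type*} [NormedAddCommGroup E] {q : (Fin 2 → ℂ) × ℂ → E}
    (hq : ContinuousOn q kernelDomain) {K : Set (Fin 2 → ℂ)} (hK : IsCompact K)
    (hKc : K ⊆ cutRegion 2) :
    ∃ C, ∀ z ∈ K, ∀ x ∈ Set.Ioi (0 : ℝ), ‖q (z, (Real.exp (-x) : ℂ))‖ ≤ C := by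
  have hc : IsCompact (K ×ˢ (Complex.ofReal '' Set.Icc (0 : ℝ) 1)) :=
    hK.prod (isCompact_Icc.image Complex.continuous_ofReal)
  obtain ⟨C, hC⟩ := hc.exists_bound_of_continuousOn (hq.mono fun p hp => by
    obtain ⟨z, u⟩ := p
    obtain ⟨hz, u, hu, rfl⟩ := hp
    exact mem_kernelDomain (hKc hz) hu)
  exact ⟨C, fun z hz x hx => hC _ ⟨hz, _, exp_neg_mem_Icc hx, rfl⟩⟩

lemma integrableOn_polylogKernel (d : ℕ) {z : Fin 2 → ℂ} (hz : z ∈ cutRegion 2) :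
    IntegrableOn (fun x => gammaWeight d x • polylogKernel z (Real.exp (-x) : ℂ)) (Set.Ioi 0) := by
  obtain ⟨C, hC⟩ := exists_kernel_bound continuousOn_polylogKernel
    isCompact_singleton (Set.singleton_subset_iff.2 hz)
  exact integrableOn_smul_gammaWeight d
    (continuousOn_exp_kernel continuousOn_polylogKernel hz) (hC z rfl)

lemma differentiableOn_polylogIntegral (d : ℕ) :
    DifferentiableOn ℂ (polylogIntegral d) (cutRegion 2) := by
  intro z hz
  obtain ⟨ε, hε, hball⟩ := Metric.nhds_basis_closedBall.mem_iff.1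
    ((isOpen_cutRegion 2).mem_nhds hz)
  obtain ⟨C, hC⟩ := exists_kernel_bound continuousOn_polylogKernelDeriv
    (isCompact_closedBall z ε) hball
  refine (hasFDerivAt_integral_of_dominated_of_fderiv_le (𝕜 := ℂ)
    (F := fun z x => gammaWeight d x • polylogKernel z (Real.exp (-x) : ℂ))
    (F' := fun z x => gammaWeight d x • polylogKernelDeriv (z, (Real.exp (-x) : ℂ)))
    (bound := fun x => gammaWeight d x * C)
    (Metric.closedBall_mem_nhds z hε) ?_ (integrableOn_polylogKernel d hz) ?_ ?_
    ((integrableOn_gammaWeight d).mul_const C) ?_).differentiableAt.differentiableWithinAt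
  · filter_upwards [(isOpen_cutRegion 2).mem_nhds hz] with y hy
    exact (integrableOn_polylogKernel d hy).1
  · exact ((continuous_gammaWeight d).continuousOn.smul
      (continuousOn_exp_kernel continuousOn_polylogKernelDeriv hz)).aestronglyMeasurable
      measurableSet_Ioi
  · refine (ae_restrict_iff' measurableSet_Ioi).2 (Eventually.of_forall fun x hx y hy => ?_)
    rw [norm_smul, Real.norm_of_nonneg (gammaWeight_nonneg d hx)]
    exact mul_le_mul_of_nonneg_left (hC y hy x hx) (gammaWeight_nonneg d hx)
  · refine (ae_restrict_iff' measurableSet_Ioi).2 (Eventually.of_forall fun x hx y hy => ?_)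
    exact (hasFDerivAt_polylogKernel
      (mem_kernelDomain (hball hy) (exp_neg_mem_Icc hx))).const_smul (gammaWeight d x)

/-- Pairs `0 < n₁ < n₂` are parametrized by `(n₁ - 1, n₂ - n₁ - 1)`. -/
def incTupleTwoEquiv : IncTuple 2 ≃ ℕ × ℕ where
  toFun n := (n.1 0 - 1, n.1 1 - n.1 0 - 1)
  invFun p := ⟨![p.1 + 1, p.1 + p.2 + 2], by
    refine ⟨Fin.strictMono_iff_lt_succ.2 fun i => ?_, fun i => ?_⟩
    · fin_cases i; simp
    · fin_cases i <;> simp⟩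
  left_inv n := by
    have h0 := n.2.2 0
    have h1 : n.1 0 < n.1 1 := n.2.1 Fin.zero_lt_one
    refine Subtype.ext (funext fun i => ?_)
    fin_cases i
    · simp; omega
    · simp; omega
  right_inv p := by
    refine Prod.ext ?_ ?_
    · simp
    · simp; omega

lemma polylogSeries_two (d : ℕ) (z : Fin 2 → ℂ) :
    polylogSeries ![1, d + 1] z = ∑' p : ℕ × ℕ,
      z 0 ^ (p.1 + 1) / (p.1 + 1) * z 1 ^ (p.2 + 1) *
        (1 / ((p.1 + p.2 + 1 : ℕ) + 1) ^ (d + 1)) := by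
  rw [polylogSeries, ← incTupleTwoEquiv.symm.tsum_eq]
  refine tsum_congr fun p => ?_
  rw [Fin.prod_univ_two]
  have h : p.1 + p.2 + 2 - (p.1 + 1) = p.2 + 1 := by omega
  simp [incTupleTwoEquiv, gap, h]
  ring

lemma hasSum_mul_of_summable_norm {f g : ℕ → ℂ} {a b : ℂ} (hf : HasSum f a) (hg : HasSum g b)
    (hf' : Summable fun n => ‖f n‖) (hg' : Summable fun n => ‖g n‖) :
    HasSum (fun p : ℕ × ℕ => f p.1 * g p.2) (a * b) :=
  hf.mul hg (summable_mul_of_summable_norm hf' hg')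

lemma hasSum_polylogKernel {z : Fin 2 → ℂ} (hz : ∀ j, ‖z j‖ < 1) {u : ℝ}
    (hu : u ∈ Set.Icc (0 : ℝ) 1) :
    HasSum (fun p : ℕ × ℕ => z 0 ^ (p.1 + 1) / (p.1 + 1) * z 1 ^ (p.2 + 1) *
      (u : ℂ) ^ (p.1 + p.2 + 1)) (polylogKernel z u) := by
  have hn : ∀ j, ‖z j * u‖ < 1 := fun j => by
    rw [norm_mul, Complex.norm_real, Real.norm_of_nonneg hu.1]
    exact (mul_le_of_le_one_right (norm_nonneg _) hu.2).trans_lt (hz j)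
  have h0 : HasSum (fun n : ℕ => (z 0 * u) ^ (n + 1) / (n + 1 : ℂ))
      (-Complex.log (1 - z 0 * u)) := by
    have := (hasSum_nat_add_iff' 1).2 (Complex.hasSum_taylorSeries_neg_log (hn 0))
    simpa using this
  have h1 : HasSum (fun n : ℕ => z 1 * (z 1 * u) ^ n) (z 1 / (1 - z 1 * u)) := by
    rw [div_eq_mul_inv]
    exact (hasSum_geometric_of_norm_lt_one (hn 1)).mul_left _
  have hs0 : Summable fun n : ℕ => ‖(z 0 * u) ^ (n + 1) / (n + 1 : ℂ)‖ := by
    refine Summable.of_nonneg_of_le (fun _ => norm_nonneg _) (fun n => ?_)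
      (summable_geometric_of_lt_one (norm_nonneg _) (hn 0))
    rw [norm_div, norm_pow, pow_succ]
    have h3 : ‖(n + 1 : ℂ)‖ = n + 1 := by exact_mod_cast Complex.norm_natCast (n + 1)
    rw [h3, div_le_iff₀ (by positivity)]
    have : (0 : ℝ) ≤ n := n.cast_nonneg
    refine mul_le_mul_of_nonneg_left ?_ (by positivity)
    linarith [hn 0]
  have hs1 : Summable fun n : ℕ => ‖z 1 * (z 1 * u) ^ n‖ := by
    refine ((summable_geometric_of_lt_one (norm_nonneg _) (hn 1)).mul_left ‖z 1‖).congr fun n => ?_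
    rw [norm_mul (z 1) ((z 1 * u) ^ n), norm_pow]
  refine hasSum_of_eq (hasSum_mul_of_summable_norm h0 h1 hs0 hs1) fun p => ?_
  rw [mul_pow, mul_pow, pow_succ (z 1), add_right_comm, pow_add (u : ℂ)]
  ring

lemma polylogIntegral_eq_series (d : ℕ) {z : Fin 2 → ℂ} (hz : ∀ j, ‖z j‖ < 1) :
    polylogIntegral d z = polylogSeries ![1, d + 1] z := by
  set c : ℕ × ℕ → ℂ := fun p => z 0 ^ (p.1 + 1) / (p.1 + 1) * z 1 ^ (p.2 + 1) with hc
  have hcs : Summable fun p => ‖c p‖ := by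
    have h0 := (summable_geometric_of_lt_one (norm_nonneg _) (hz 0))
    have h1 := (summable_geometric_of_lt_one (norm_nonneg _) (hz 1))
    refine Summable.of_nonneg_of_le (fun _ => norm_nonneg _) (fun p => ?_)
      (h0.mul_of_nonneg h1 (fun n => by positivity) fun n => by positivity)
    have h3 : ‖(p.1 + 1 : ℂ)‖ = p.1 + 1 := by exact_mod_cast Complex.norm_natCast (p.1 + 1)
    rw [hc, norm_mul, norm_div, norm_pow, norm_pow, h3, pow_succ, pow_succ]
    refine mul_le_mul ?_ (mul_le_of_le_one_right (by positivity) (hz 1).le) (by positivity)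
      (by positivity)
    have : (0 : ℝ) ≤ p.1 := p.1.cast_nonneg
    rw [div_le_iff₀ (by positivity)]
    exact mul_le_mul_of_nonneg_left (by linarith [hz 0]) (by positivity)
  have hint : ∀ n : ℕ, IntegrableOn (fun x => Real.exp (-x) ^ n * gammaWeight d x)
      (Set.Ioi 0) := fun n => by
    have := integrableOn_smul_gammaWeight d (q := fun x => Real.exp (-x) ^ n) (C := 1)
      (by fun_prop) fun x hx => by
        rw [norm_pow, Real.norm_of_nonneg (exp_neg_mem_Icc hx).1]
        exact pow_le_one₀ (exp_neg_mem_Icc hx).1 (exp_neg_mem_Icc hx).2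
    simpa only [smul_eq_mul, mul_comm] using this
  have hF : ∀ p : ℕ × ℕ, Integrable (fun x : ℝ => c p *
      ((Real.exp (-x) ^ (p.1 + p.2 + 1) * gammaWeight d x : ℝ) : ℂ))
      (volume.restrict (Set.Ioi 0)) := fun p => ((hint _).ofReal).const_mul _
  have key := integrable_and_hasSum_integral hF (f := fun x =>
    gammaWeight d x • polylogKernel z (Real.exp (-x) : ℂ)) ?_ ?_
  · rw [polylogSeries_two]
    refine (key.2.tsum_eq.symm.trans (tsum_congr fun p => ?_))
    rw [integral_const_mul, integral_complex_ofReal, integral_exp_mul_gammaWeight]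
    push_cast
    rfl
  · refine Summable.of_nonneg_of_le (fun p => integral_nonneg fun _ => norm_nonneg _)
      (fun p => ?_) hcs
    have : ∫ x in Set.Ioi (0 : ℝ), ‖c p *
        ((Real.exp (-x) ^ (p.1 + p.2 + 1) * gammaWeight d x : ℝ) : ℂ)‖ =
        ∫ x in Set.Ioi (0 : ℝ), ‖c p‖ * (Real.exp (-x) ^ (p.1 + p.2 + 1) * gammaWeight d x) := by
      refine setIntegral_congr_fun measurableSet_Ioi fun x hx => ?_
      simp only [norm_mul, Complex.norm_real]
      rw [← norm_mul, Real.norm_of_nonneg]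
      exact mul_nonneg (by positivity) (gammaWeight_nonneg d hx)
    rw [this, integral_const_mul, integral_exp_mul_gammaWeight]
    refine mul_le_of_le_one_right (norm_nonneg _) ?_
    rw [div_le_one (by positivity)]
    exact one_le_pow₀ (by linarith [Nat.cast_nonneg (α := ℝ) (p.1 + p.2 + 1)])
  · refine (ae_restrict_iff' measurableSet_Ioi).2 (Eventually.of_forall fun x hx => ?_)
    have := (hasSum_polylogKernel hz (exp_neg_mem_Icc hx)).mul_right (gammaWeight d x : ℂ)
    rw [Complex.real_smul, mul_comm]
    refine hasSum_of_eq this fun p => ?_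
    push_cast
    ring

/-- Two continuations agree: along the line through `0` and `z` this is the identity theorem in one
variable. -/
lemma IsPolylogContinuation.eqOn {r : ℕ} {k : Fin r → ℕ} {L L' : (Fin r → ℂ) → ℂ}
    (h : IsPolylogContinuation k L) (h' : IsPolylogContinuation k L') :
    Set.EqOn L L' (cutRegion r) := by
  intro z hz
  set U : Set ℂ := (fun c : ℂ => c • z) ⁻¹' cutRegion r with hU
  have hUo : IsOpen U := (isOpen_cutRegion r).preimage (by fun_prop)
  have h0 : (0 : ℂ) ∈ U := by
    intro j x hx he
    have : x = 0 := by simpa using he.symm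
    linarith
  have hstar : StarConvex ℝ (0 : ℂ) U := by
    refine (starConvex_zero_iff).2 fun c hc a ha ha1 j x hx he => ?_
    have hane : a ≠ 0 := by
      rintro rfl
      have : x = 0 := by simpa using he.symm
      linarith
    have hapos : 0 < a := lt_of_le_of_ne ha hane.symm
    refine hc j (x / a) ((one_le_div hapos).2 (ha1.trans hx)) ?_
    have hac : (a : ℂ) ≠ 0 := by exact_mod_cast hane
    simp only [Pi.smul_apply, smul_eq_mul, Complex.real_smul, Complex.ofReal_div] at he ⊢
    rw [← he]
    field_simp
  have hd : DifferentiableOn ℂ (fun c : ℂ => c • z) U := by fun_prop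
  have hL : AnalyticOnNhd ℂ (fun c => L (c • z)) U :=
    (h.differentiableOn.comp hd fun _ hc => hc).analyticOnNhd hUo
  have hL' : AnalyticOnNhd ℂ (fun c => L' (c • z)) U :=
    (h'.differentiableOn.comp hd fun _ hc => hc).analyticOnNhd hUo
  have hev : (fun c => L (c • z)) =ᶠ[𝓝 (0 : ℂ)] fun c => L' (c • z) := by
    have : ∀ᶠ c : ℂ in 𝓝 0, c • z ∈ Metric.ball (0 : Fin r → ℂ) 1 := by
      have hc : ContinuousAt (fun c : ℂ => c • z) 0 := by fun_prop
      exact hc.eventually 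
        (by simp only [zero_smul]; exact Metric.ball_mem_nhds (0 : Fin r → ℂ) one_pos)
    filter_upwards [this] with c hc
    have hn : ∀ j, ‖(c • z) j‖ < 1 := fun j =>
      (norm_le_pi_norm _ j).trans_lt (by simpa using hc)
    rw [h.eq_series _ hn, h'.eq_series _ hn]
  have := hL.eqOn_of_preconnected_of_eventuallyEq hL'
    (hstar.isPathConnected h0).isConnected.isPreconnected h0 hev
    (show (1 : ℂ) ∈ U by simpa [hU] using hz)
  simpa using this

lemma isPolylogContinuation_polylogIntegral (d : ℕ) :
    IsPolylogContinuation ![1, d + 1] (polylogIntegral d) :=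
  ⟨differentiableOn_polylogIntegral d, fun _ hz => polylogIntegral_eq_series d hz⟩

lemma polylog_eq_polylogIntegral (d : ℕ) {z : Fin 2 → ℂ} (hz : z ∈ cutRegion 2) :
    polylog ![1, d + 1] z = polylogIntegral d z := by
  have h : ∃ L, IsPolylogContinuation ![1, d + 1] L := ⟨_, isPolylogContinuation_polylogIntegral d⟩
  rw [polylog, dif_pos h]
  exact h.choose_spec.eqOn (isPolylogContinuation_polylogIntegral d) hz

/-! ### The moments of `1 - e⁻ˣ` -/

/-- The sums `n ↦ ∑_{n ≥ m₁ ≥ ⋯ ≥ m_d ≥ 1} 1 / (m₁ ⋯ m_d)`. -/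
noncomputable def starSum : ℕ → ℕ → ℝ
  | 0 => posOne
  | d + 1 => partialSum (divIdx (starSum d)) + divIdx (starSum d)

lemma continuous_one_sub_exp_pow (n : ℕ) : Continuous fun x : ℝ => (1 - Real.exp (-x)) ^ n := by
  fun_prop

lemma one_sub_exp_mem {x : ℝ} (hx : x ∈ Set.Ioi (0 : ℝ)) :
    0 < 1 - Real.exp (-x) ∧ 1 - Real.exp (-x) < 1 :=
  ⟨sub_pos.2 (Real.exp_lt_one_iff.2 (by simpa using hx)), by linarith [Real.exp_pos (-x)]⟩

lemma integrableOn_moment (d n : ℕ) :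
    IntegrableOn (fun x => gammaWeight d x * (1 - Real.exp (-x)) ^ n) (Set.Ioi 0) := by
  refine integrableOn_smul_gammaWeight d (C := 1) (continuous_one_sub_exp_pow n).continuousOn
    fun x hx => ?_
  have := one_sub_exp_mem hx
  rw [norm_pow, Real.norm_of_nonneg this.1.le]
  exact pow_le_one₀ this.1.le this.2.le

lemma hasDerivAt_one_sub_exp_pow (n : ℕ) (x : ℝ) :
    HasDerivAt (fun x => (1 - Real.exp (-x)) ^ (n + 1))
      ((n + 1) * (1 - Real.exp (-x)) ^ n * Real.exp (-x)) x := by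
  have h := (((hasDerivAt_neg x).exp.const_sub 1).pow (n + 1))
  refine h.congr_deriv ?_
  push_cast
  ring

lemma tendsto_one_sub_exp_pow (n : ℕ) :
    Tendsto (fun x : ℝ => (1 - Real.exp (-x)) ^ n) atTop (𝓝 1) := by
  have := (tendsto_const_nhds (x := (1 : ℝ))).sub Real.tendsto_exp_neg_atTop_nhds_zero
  simpa using this.pow n

lemma one_sub_one_sub_exp_pow (n : ℕ) (x : ℝ) :
    1 - (1 - Real.exp (-x)) ^ n =
      Real.exp (-x) * ∑ m ∈ Finset.range n, (1 - Real.exp (-x)) ^ m := by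
  have := mul_neg_geom_sum (1 - Real.exp (-x)) n
  rw [← this]
  ring

lemma integral_moment_zero (n : ℕ) :
    ∫ x in Set.Ioi (0 : ℝ), gammaWeight 0 x * (1 - Real.exp (-x)) ^ n = 1 / (n + 1) := by
  have h := integral_Ioi_of_hasDerivAt_of_tendsto (a := 0) (m := 1)
    (f := fun x : ℝ => (1 - Real.exp (-x)) ^ (n + 1))
    (f' := fun x => (n + 1) * (gammaWeight 0 x * (1 - Real.exp (-x)) ^ n))
    (continuous_one_sub_exp_pow _).continuousWithinAt
    (fun x _ => (hasDerivAt_one_sub_exp_pow n x).congr_deriv (by simp [gammaWeight]; ring))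
    ((integrableOn_moment 0 n).const_mul _) (tendsto_one_sub_exp_pow _)
  rw [integral_const_mul] at h
  rw [eq_div_iff (by positivity), mul_comm, h]
  simp

/-- Integration by parts against `(1 - e⁻ˣ) ^ (n + 1) - 1`. -/
lemma integral_moment_succ (d n : ℕ) :
    (n + 1) * ∫ x in Set.Ioi (0 : ℝ), gammaWeight (d + 1) x * (1 - Real.exp (-x)) ^ n =
      ∑ m ∈ Finset.range (n + 1),
        ∫ x in Set.Ioi (0 : ℝ), gammaWeight d x * (1 - Real.exp (-x)) ^ m := by
  have hlim : Tendsto (fun x : ℝ => ((1 - Real.exp (-x)) ^ (n + 1) - 1) *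
      (x ^ (d + 1) / (d + 1)!)) atTop (𝓝 0) := by
    have h1 : Tendsto (fun x : ℝ => ∑ m ∈ Finset.range (n + 1), (1 - Real.exp (-x)) ^ m) atTop
        (𝓝 (∑ m ∈ Finset.range (n + 1), 1)) :=
      tendsto_finsetSum _ fun m _ => tendsto_one_sub_exp_pow m
    have h2 := (((Real.tendsto_pow_mul_exp_neg_atTop_nhds_zero (d + 1)).div_const
      ((d + 1)! : ℝ)).mul h1).neg
    rw [zero_div, zero_mul, neg_zero] at h2
    refine h2.congr fun x => ?_
    rw [← neg_sub 1 ((1 - Real.exp (-x)) ^ (n + 1)), one_sub_one_sub_exp_pow]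
    ring
  have h := integral_Ioi_of_hasDerivAt_of_tendsto (a := 0) (m := 0)
    (f := fun x : ℝ => ((1 - Real.exp (-x)) ^ (n + 1) - 1) * (x ^ (d + 1) / (d + 1)!))
    (f' := fun x => (n + 1) * (gammaWeight (d + 1) x * (1 - Real.exp (-x)) ^ n) -
      ∑ m ∈ Finset.range (n + 1), gammaWeight d x * (1 - Real.exp (-x)) ^ m)
    (Continuous.continuousWithinAt (by fun_prop)) (fun x _ => ?_)
    (((integrableOn_moment _ n).const_mul _).sub
      (integrable_finsetSum _ fun m _ => integrableOn_moment d m)) hlim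
  · rw [integral_sub ((integrableOn_moment _ n).const_mul _)
      (integrable_finsetSum _ fun m _ => integrableOn_moment d m), integral_const_mul,
      integral_finsetSum _ fun m _ => integrableOn_moment d m] at h
    have h0 : (0 : ℝ) - ((1 - Real.exp (-0)) ^ (n + 1) - 1) * (0 ^ (d + 1) / (d + 1)!) = 0 := by
      simp
    exact sub_eq_zero.1 (h.trans h0)
  · have h1 : HasDerivAt (fun x : ℝ => x ^ (d + 1) / ((d + 1)! : ℝ)) (x ^ d / d !) x := by
      refine ((hasDerivAt_pow (d + 1) x).div_const _).congr_deriv ?_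
      rw [Nat.factorial_succ, Nat.add_sub_cancel]
      push_cast
      rw [mul_div_mul_left _ _ (by positivity)]
    refine (((hasDerivAt_one_sub_exp_pow n x).sub_const 1).mul h1).congr_deriv ?_
    rw [← neg_sub 1 ((1 - Real.exp (-x)) ^ (n + 1)), one_sub_one_sub_exp_pow, ← Finset.mul_sum]
    simp only [gammaWeight]
    ring

lemma integral_moment (d n : ℕ) :
    ∫ x in Set.Ioi (0 : ℝ), gammaWeight d x * (1 - Real.exp (-x)) ^ n =
      divIdx (starSum d) (n + 1) := by
  induction d generalizing n with
  | zero => rw [integral_moment_zero]; simp [divIdx_apply, starSum, posOne]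
  | succ d ih =>
    have h := integral_moment_succ d n
    simp only [ih] at h
    have h2 : starSum (d + 1) (n + 1) =
        ∑ m ∈ Finset.range (n + 1), divIdx (starSum d) (m + 1) := by
      rw [starSum, Pi.add_apply, partialSum_apply, ← Finset.sum_range_succ,
        Finset.sum_range_succ']
      simp [divIdx_apply]
    rw [divIdx_apply, h2, ← h]
    push_cast
    field_simp

/-- `∫ (1 - e⁻ˣ) ^ j (1 - (1 - e⁻ˣ) ^ (i + 1)) / (i + 1) · x ^ d e⁻ˣ / d! dx`, the difference of two
moments. -/
noncomputable def momentDiff (d : ℕ) (p : ℕ × ℕ) : ℝ :=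
  (divIdx (starSum d) (p.2 + 1) - divIdx (starSum d) (p.1 + p.2 + 2)) / (p.1 + 1)

/-- The integrand of `momentDiff`. -/
noncomputable def momentDiffIntegrand (d : ℕ) (p : ℕ × ℕ) (x : ℝ) : ℝ :=
  gammaWeight d x * (1 - Real.exp (-x)) ^ p.2 * ((1 - (1 - Real.exp (-x)) ^ (p.1 + 1)) / (p.1 + 1))

lemma momentDiffIntegrand_eq (d : ℕ) (p : ℕ × ℕ) (x : ℝ) :
    momentDiffIntegrand d p x = (gammaWeight d x * (1 - Real.exp (-x)) ^ p.2 -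
      gammaWeight d x * (1 - Real.exp (-x)) ^ (p.1 + p.2 + 1)) / (p.1 + 1) := by
  rw [momentDiffIntegrand]
  ring

lemma integrableOn_momentDiffIntegrand (d : ℕ) (p : ℕ × ℕ) :
    IntegrableOn (momentDiffIntegrand d p) (Set.Ioi 0) := by
  rw [funext (momentDiffIntegrand_eq d p)]
  exact ((integrableOn_moment d _).sub (integrableOn_moment d _)).div_const _

lemma integral_momentDiffIntegrand (d : ℕ) (p : ℕ × ℕ) :
    ∫ x in Set.Ioi (0 : ℝ), momentDiffIntegrand d p x = momentDiff d p := by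
  simp only [momentDiffIntegrand_eq]
  rw [integral_div, integral_sub (integrableOn_moment d _) (integrableOn_moment d _),
    integral_moment, integral_moment]
  rfl

lemma momentDiffIntegrand_nonneg (d : ℕ) (p : ℕ × ℕ) {x : ℝ} (hx : x ∈ Set.Ioi (0 : ℝ)) :
    0 ≤ momentDiffIntegrand d p x := by
  have := one_sub_exp_mem hx
  have h1 : (1 - Real.exp (-x)) ^ (p.1 + 1) ≤ 1 := pow_le_one₀ this.1.le this.2.le
  exact mul_nonneg (mul_nonneg (gammaWeight_nonneg d hx) (pow_nonneg this.1.le _))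
    (div_nonneg (by linarith) (by positivity))

lemma momentDiff_nonneg (d : ℕ) (p : ℕ × ℕ) : 0 ≤ momentDiff d p := by
  rw [← integral_momentDiffIntegrand]
  exact setIntegral_nonneg measurableSet_Ioi fun x hx => momentDiffIntegrand_nonneg d p hx

lemma momentDiff_le (d : ℕ) (p : ℕ × ℕ) : momentDiff d p ≤ divIdx (starSum d) 1 := by
  have h0 := integral_moment d 0
  rw [zero_add] at h0
  rw [← integral_momentDiffIntegrand, ← h0]
  refine setIntegral_mono_on (integrableOn_momentDiffIntegrand d p) (integrableOn_moment d 0)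
    measurableSet_Ioi fun x hx => ?_
  have := one_sub_exp_mem hx
  have h2 : 0 ≤ (1 - Real.exp (-x)) ^ (p.1 + 1) := pow_nonneg this.1.le _
  rw [momentDiffIntegrand, pow_zero, mul_assoc]
  refine mul_le_mul_of_nonneg_left ?_ (gammaWeight_nonneg d hx)
  have h3 : (1 - (1 - Real.exp (-x)) ^ (p.1 + 1)) / ((p.1 : ℝ) + 1) ≤ 1 := by
    rw [div_le_one (by positivity)]
    have : (0 : ℝ) ≤ p.1 := p.1.cast_nonneg
    linarith
  calc _ ≤ (1 - Real.exp (-x)) ^ p.2 * 1 :=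
        mul_le_mul_of_nonneg_left h3 (pow_nonneg this.1.le _)
    _ ≤ 1 := by rw [mul_one]; exact pow_le_one₀ this.1.le this.2.le

/-! ### The integral as a double series -/

/-- `polylogKernel z u / (z₁ z₂)` at `z₁ = 1 - e^s`, `z₂ = 1 - e^t`. -/
noncomputable def etaKernel (s t u : ℝ) : ℝ :=
  Real.log (1 + (Real.exp s - 1) * u) / (Real.exp s - 1) / (1 + (Real.exp t - 1) * u)

/-- With `a = 1 - e⁻ˢ`, `b = 1 - e⁻ᵗ` and `v = 1 - u` one has `1 + (e^s - 1) u = e^s (1 - a v)` and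
`1 + (e^t - 1) u = e^t (1 - b v)`, and the logarithm and the fraction expand in powers of
`a`, `a v` and `b v`. -/
lemma hasSum_etaKernel {s t v : ℝ} (hs : s ∈ Set.Ioi (0 : ℝ)) (ht : t ∈ Set.Ioi (0 : ℝ))
    (hv : 0 < v ∧ v < 1) :
    HasSum (fun p : ℕ × ℕ => (1 - v ^ (p.1 + 1)) / (p.1 + 1) * (1 - Real.exp (-s)) ^ p.1 *
      Real.exp (-s) * (((1 - Real.exp (-t)) * v) ^ p.2 * Real.exp (-t)))
      (etaKernel s t (1 - v)) := by
  have ha := one_sub_exp_mem hs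
  have hb := one_sub_exp_mem ht
  have hes : Real.exp s * Real.exp (-s) = 1 := by rw [← Real.exp_add]; simp
  have het : Real.exp t * Real.exp (-t) = 1 := by rw [← Real.exp_add]; simp
  have hs1 : 1 < Real.exp s := Real.one_lt_exp_iff.2 hs
  set a := 1 - Real.exp (-s) with hadef
  set b := 1 - Real.exp (-t) with hbdef
  have hav : a * v < 1 := by nlinarith
  have hbv : b * v < 1 := by nlinarith
  have hav0 : 0 < a * v := mul_pos ha.1 hv.1
  have hbv0 : 0 < b * v := mul_pos hb.1 hv.1
  have h1 : HasSum (fun i : ℕ => (1 - v ^ (i + 1)) / ((i : ℝ) + 1) * a ^ i * Real.exp (-s))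
      (Real.log (1 + (Real.exp s - 1) * (1 - v)) / (Real.exp s - 1)) := by
    have h := ((Real.hasSum_pow_div_log_of_abs_lt_one (x := a)
        (by rw [abs_of_pos ha.1]; exact ha.2)).sub
      (Real.hasSum_pow_div_log_of_abs_lt_one (x := a * v)
        (by rw [abs_of_pos hav0]; exact hav))).mul_right (Real.exp (-s) / a)
    have e : (-Real.log (1 - a) - -Real.log (1 - a * v)) * (Real.exp (-s) / a) =
        Real.log (1 + (Real.exp s - 1) * (1 - v)) / (Real.exp s - 1) := by
      have e1 : 1 + (Real.exp s - 1) * (1 - v) = Real.exp s * (1 - a * v) := by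
        rw [hadef]; linear_combination -v * hes
      have e2 : Real.exp s - 1 = Real.exp s * a := by rw [hadef]; linear_combination hes
      have e3 : 1 - a = Real.exp (-s) := by rw [hadef]; ring
      rw [e1, e2, e3, Real.log_mul (Real.exp_ne_zero _) (by linarith), Real.log_exp, Real.log_exp,
        Real.exp_neg]
      have := ha.1.ne'
      field_simp
      ring
    rw [e] at h
    refine hasSum_of_eq h fun i => ?_
    rw [mul_pow, pow_succ a]
    have := ha.1.ne'
    field_simp
  have h2 : HasSum (fun j : ℕ => (b * v) ^ j * Real.exp (-t))
      (1 / (1 + (Real.exp t - 1) * (1 - v))) := by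
    have e : (1 - b * v)⁻¹ * Real.exp (-t) = 1 / (1 + (Real.exp t - 1) * (1 - v)) := by
      have e1 : 1 + (Real.exp t - 1) * (1 - v) = Real.exp t * (1 - b * v) := by
        rw [hbdef]; linear_combination -v * het
      rw [e1, Real.exp_neg, one_div, mul_inv, mul_comm]
    rw [← e]
    exact (hasSum_geometric_of_lt_one hbv0.le hbv).mul_right _
  have h3 := h1.mul h2 (h1.summable.mul_of_nonneg h2.summable (fun i => ?_) fun j => ?_)
  · rw [mul_one_div] at h3
    exact h3
  · have : v ^ (i + 1) ≤ 1 := pow_le_one₀ hv.1.le hv.2.le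
    exact mul_nonneg (mul_nonneg (div_nonneg (by linarith) (by positivity)) (pow_nonneg ha.1.le _))
      (Real.exp_pos _).le
  · exact mul_nonneg (pow_nonneg hbv0.le _) (Real.exp_pos _).le

lemma hasSum_integral_etaKernel (d : ℕ) {s t : ℝ} (hs : s ∈ Set.Ioi (0 : ℝ))
    (ht : t ∈ Set.Ioi (0 : ℝ)) :
    HasSum (fun p : ℕ × ℕ => momentDiff d p * ((1 - Real.exp (-s)) ^ p.1 * Real.exp (-s) *
      ((1 - Real.exp (-t)) ^ p.2 * Real.exp (-t))))
      (∫ x in Set.Ioi (0 : ℝ), gammaWeight d x * etaKernel s t (Real.exp (-x))) := by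
  have ha := one_sub_exp_mem hs
  have hb := one_sub_exp_mem ht
  set c : ℕ × ℕ → ℝ := fun p => (1 - Real.exp (-s)) ^ p.1 * Real.exp (-s) *
      ((1 - Real.exp (-t)) ^ p.2 * Real.exp (-t)) with hc
  have hc0 : ∀ p, 0 ≤ c p := fun p => mul_nonneg
    (mul_nonneg (pow_nonneg ha.1.le _) (Real.exp_pos _).le)
    (mul_nonneg (pow_nonneg hb.1.le _) (Real.exp_pos _).le)
  have hcs : Summable c :=
    ((summable_geometric_of_lt_one ha.1.le ha.2).mul_right _).mul_of_nonneg
      ((summable_geometric_of_lt_one hb.1.le hb.2).mul_right _)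
      (fun i => mul_nonneg (pow_nonneg ha.1.le _) (Real.exp_pos _).le)
      (fun j => mul_nonneg (pow_nonneg hb.1.le _) (Real.exp_pos _).le)
  have key := integrable_and_hasSum_integral (μ := volume.restrict (Set.Ioi (0 : ℝ)))
    (F := fun p x => momentDiffIntegrand d p x * c p)
    (f := fun x => gammaWeight d x * etaKernel s t (Real.exp (-x)))
    (fun p => (integrableOn_momentDiffIntegrand d p).mul_const _) ?_ ?_
  · refine hasSum_of_eq key.2 fun p => ?_
    rw [integral_mul_const, integral_momentDiffIntegrand]
  · have e : ∀ p, ∫ x in Set.Ioi (0 : ℝ), ‖momentDiffIntegrand d p x * c p‖ =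
        momentDiff d p * c p := fun p => by
      rw [← integral_momentDiffIntegrand, ← integral_mul_const]
      refine setIntegral_congr_fun measurableSet_Ioi fun x hx => ?_
      exact Real.norm_of_nonneg (mul_nonneg (momentDiffIntegrand_nonneg d p hx) (hc0 p))
    simp only [e]
    exact Summable.of_nonneg_of_le (fun p => mul_nonneg (momentDiff_nonneg d p) (hc0 p))
      (fun p => mul_le_mul_of_nonneg_right (momentDiff_le d p) (hc0 p)) (hcs.mul_left _)
  · refine (ae_restrict_iff' measurableSet_Ioi).2 (Eventually.of_forall fun x hx => ?_)
    have h := (hasSum_etaKernel hs ht (one_sub_exp_mem hx)).mul_left (gammaWeight d x)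
    rw [sub_sub_cancel] at h
    refine hasSum_of_eq h fun p => ?_
    rw [momentDiffIntegrand, hc, mul_pow]
    ring

/-- The power series terms `(1 - e⁻ˢ) ^ i e⁻ˢ · (1 - e⁻ᵗ) ^ j t ^ d e⁻ᵗ / d!` in the orthant
coordinates `x = s - t` and `y = t`. -/
noncomputable def orthantTerm (d : ℕ) (p : ℕ × ℕ) (x y : ℝ) : ℝ :=
  (1 - Real.exp (-(x + y))) ^ p.1 * Real.exp (-(x + y)) *
    (gammaWeight d y * (1 - Real.exp (-y)) ^ p.2)

lemma integrable_and_integral_orthantTerm (d : ℕ) (p : ℕ × ℕ) :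
    IntegrableOn (fun q : ℝ × ℝ => orthantTerm d p q.1 q.2) (Set.Ioi 0 ×ˢ Set.Ioi 0) ∧
      ∫ q in Set.Ioi (0 : ℝ) ×ˢ Set.Ioi (0 : ℝ), orthantTerm d p q.1 q.2 = momentDiff d p := by
  have hcont : Continuous fun q : ℝ × ℝ => orthantTerm d p q.1 q.2 := by
    have := continuous_gammaWeight d
    unfold orthantTerm
    fun_prop
  have hint : IntegrableOn (fun q : ℝ × ℝ => orthantTerm d p q.1 q.2)
      (Set.Ioi 0 ×ˢ Set.Ioi 0) := by
    have h1 : Integrable (fun q : ℝ × ℝ => gammaWeight 0 q.1 * gammaWeight d q.2)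
        (volume.restrict (Set.Ioi 0 ×ˢ Set.Ioi 0)) := by
      rw [Measure.volume_eq_prod, ← Measure.prod_restrict]
      exact (integrableOn_gammaWeight 0).mul_prod (integrableOn_gammaWeight d)
    refine h1.mono' hcont.aestronglyMeasurable ?_
    refine (ae_restrict_iff' (measurableSet_Ioi.prod measurableSet_Ioi)).2
      (Eventually.of_forall fun q hq => ?_)
    obtain ⟨x, y⟩ := q
    obtain ⟨hx, hy⟩ : 0 < x ∧ 0 < y := hq
    have hxy := one_sub_exp_mem (x := x + y) (by simpa using add_pos hx hy)
    have hy' := one_sub_exp_mem (x := y) hy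
    have hg := gammaWeight_nonneg d (x := y) hy
    simp only [orthantTerm]
    rw [Real.norm_of_nonneg (mul_nonneg (mul_nonneg (pow_nonneg hxy.1.le _) (Real.exp_pos _).le)
      (mul_nonneg hg (pow_nonneg hy'.1.le _)))]
    refine mul_le_mul ?_ (mul_le_of_le_one_right hg (pow_le_one₀ hy'.1.le hy'.2.le))
      (mul_nonneg hg (pow_nonneg hy'.1.le _)) (gammaWeight_nonneg 0 hx)
    refine (mul_le_of_le_one_left (Real.exp_pos _).le (pow_le_one₀ hxy.1.le hxy.2.le)).trans ?_
    simp only [gammaWeight, pow_zero, mul_one, Nat.factorial_zero, Nat.cast_one, div_one]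
    exact Real.exp_le_exp.2 (by linarith)
  refine ⟨hint, ?_⟩
  rw [Measure.volume_eq_prod, ← Measure.prod_restrict, integral_prod_symm _ (by
    rw [Measure.prod_restrict, ← Measure.volume_eq_prod]; exact hint),
    ← integral_momentDiffIntegrand]
  refine setIntegral_congr_fun measurableSet_Ioi fun y hy => ?_
  simp only [orthantTerm]
  rw [integral_mul_const, momentDiffIntegrand, mul_comm]
  congr 1
  have hd : ∀ x : ℝ, HasDerivAt (fun x => (1 - Real.exp (-(x + y))) ^ (p.1 + 1) / (p.1 + 1))
      ((1 - Real.exp (-(x + y))) ^ p.1 * Real.exp (-(x + y))) x := fun x => by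
    refine (((hasDerivAt_one_sub_exp_pow p.1 (x + y)).comp_add_const x y).div_const
      _).congr_deriv ?_
    field_simp
  have hl : Tendsto (fun x => (1 - Real.exp (-(x + y))) ^ (p.1 + 1) / ((p.1 : ℝ) + 1)) atTop
      (𝓝 (1 / (p.1 + 1))) :=
    ((tendsto_one_sub_exp_pow (p.1 + 1)).comp
      (tendsto_atTop_add_const_right _ y tendsto_id)).div_const _
  rw [integral_Ioi_of_hasDerivAt_of_nonneg' (fun x _ => hd x) (fun x hx => ?_) hl]
  · rw [zero_add]; ring
  · have hxy := one_sub_exp_mem (x := x + y) (by simpa using add_pos hx hy)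
    exact mul_nonneg (pow_nonneg hxy.1.le _) (Real.exp_pos _).le

lemma orthant_two : orthant 2 =
    MeasurableEquiv.finTwoArrow ⁻¹' (Set.Ioi (0 : ℝ) ×ˢ Set.Ioi (0 : ℝ)) := by
  ext t
  simp [orthant, Fin.forall_fin_two]

lemma integrableOn_orthantTerm (d : ℕ) (p : ℕ × ℕ) :
    IntegrableOn (fun t : Fin 2 → ℝ => orthantTerm d p (t 0) (t 1)) (orthant 2) := by
  rw [orthant_two]
  exact ((volume_preserving_finTwoArrow ℝ).integrableOn_comp_preimage
    MeasurableEquiv.finTwoArrow.measurableEmbedding).2 (integrable_and_integral_orthantTerm d p).1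

lemma integral_orthantTerm (d : ℕ) (p : ℕ × ℕ) :
    ∫ t in orthant 2, orthantTerm d p (t 0) (t 1) = momentDiff d p := by
  rw [orthant_two, ← (integrable_and_integral_orthantTerm d p).2]
  exact (volume_preserving_finTwoArrow ℝ).setIntegral_preimage_emb
    MeasurableEquiv.finTwoArrow.measurableEmbedding (fun q => orthantTerm d p q.1 q.2) _

lemma measurableSet_orthant_two : MeasurableSet (orthant 2) := by
  rw [orthant_two]
  exact MeasurableEquiv.finTwoArrow.measurable (measurableSet_Ioi.prod measurableSet_Ioi)

lemma orthantTerm_nonneg (d : ℕ) (p : ℕ × ℕ) {x y : ℝ} (hx : 0 < x) (hy : 0 < y) :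
    0 ≤ orthantTerm d p x y := by
  have hxy := one_sub_exp_mem (x := x + y) (by simpa using add_pos hx hy)
  have hy' := one_sub_exp_mem (x := y) hy
  exact mul_nonneg (mul_nonneg (pow_nonneg hxy.1.le _) (Real.exp_pos _).le)
    (mul_nonneg (gammaWeight_nonneg d hy) (pow_nonneg hy'.1.le _))

lemma etaArg_zero (t : Fin 2 → ℝ) : etaArg t 0 = -((Real.exp (t 0 + t 1) - 1 : ℝ) : ℂ) := by
  have h : (Finset.Ici 0 : Finset (Fin 2)) = {0, 1} := by decide
  simp [etaArg, h]

lemma etaArg_one (t : Fin 2 → ℝ) : etaArg t 1 = -((Real.exp (t 1) - 1 : ℝ) : ℂ) := by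
  have h : (Finset.Ici 1 : Finset (Fin 2)) = {1} := by decide
  simp [etaArg, h]

lemma etaIntegrand_eq (d e : ℕ) {t : Fin 2 → ℝ} (ht : t ∈ orthant 2) :
    etaIntegrand ![1, d + 1] ![1, e + 1] t =
      (((∫ x in Set.Ioi (0 : ℝ), gammaWeight d x * etaKernel (t 0 + t 1) (t 1) (Real.exp (-x))) *
        t 1 ^ e : ℝ) : ℂ) := by
  have hs : 0 < Real.exp (t 0 + t 1) - 1 := by
    have := Real.one_lt_exp_iff.2 (add_pos (ht 0) (ht 1)); linarith
  have ht1 : 0 < Real.exp (t 1) - 1 := by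
    have := Real.one_lt_exp_iff.2 (ht 1); linarith
  have hz : etaArg t ∈ cutRegion 2 := by
    intro j x hx h
    fin_cases j
    · simp only [Fin.zero_eta, etaArg_zero, ← Complex.ofReal_neg, Complex.ofReal_inj] at h
      linarith
    · simp only [Fin.mk_one, etaArg_one, ← Complex.ofReal_neg, Complex.ofReal_inj] at h
      linarith
  rw [etaIntegrand, polylog_eq_polylogIntegral d hz, polylogIntegral, Fin.prod_univ_two,
    Fin.prod_univ_two]
  simp only [Matrix.cons_val_zero, Matrix.cons_val_one, Nat.sub_self, pow_zero, one_mul,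
    Nat.add_sub_cancel]
  rw [Complex.ofReal_mul, Complex.ofReal_pow, ← integral_complex_ofReal, ← integral_div]
  congr 1
  refine setIntegral_congr_fun measurableSet_Ioi fun x hx => ?_
  have hu := exp_neg_mem_Icc hx
  simp only [polylogKernel, etaArg_zero, etaArg_one, etaKernel, Complex.real_smul]
  set S := Real.exp (t 0 + t 1) - 1
  set T := Real.exp (t 1) - 1
  set u := Real.exp (-x)
  have h1 : 1 - -(S : ℂ) * (u : ℂ) = ((1 + S * u : ℝ) : ℂ) := by push_cast; ring
  have h2 : 1 - -(T : ℂ) * (u : ℂ) = ((1 + T * u : ℝ) : ℂ) := by push_cast; ring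
  have hSu : 0 ≤ S * u := mul_nonneg hs.le hu.1
  have hTu : 0 ≤ T * u := mul_nonneg ht1.le hu.1
  rw [h1, h2, ← Complex.ofReal_log (by linarith)]
  have hS0 : (S : ℂ) ≠ 0 := by exact_mod_cast hs.ne'
  have hT0 : (T : ℂ) ≠ 0 := by exact_mod_cast ht1.ne'
  have hT1 : ((1 + T * u : ℝ) : ℂ) ≠ 0 := by exact_mod_cast (by linarith : 1 + T * u ≠ 0)
  rw [Complex.ofReal_mul, Complex.ofReal_div, Complex.ofReal_div]
  field_simp

/-- The integral defining `η(1, d + 1; 1, e + 1)` is a convergent double series of nonnegative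
terms as soon as that series converges. -/
lemma integrableOn_and_eta_eq (d e : ℕ)
    (h : Summable fun p : ℕ × ℕ => momentDiff d p * momentDiff e p) :
    IntegrableOn (etaIntegrand ![1, d + 1] ![1, e + 1]) (orthant 2) ∧
      eta ![1, d + 1] ![1, e + 1] =
        ((∑' p : ℕ × ℕ, momentDiff d p * momentDiff e p : ℝ) : ℂ) := by
  set g : (Fin 2 → ℝ) → ℝ := fun t =>
    (∫ x in Set.Ioi (0 : ℝ), gammaWeight d x * etaKernel (t 0 + t 1) (t 1) (Real.exp (-x))) *
      t 1 ^ e with hg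
  have key := integrable_and_hasSum_integral (μ := volume.restrict (orthant 2))
    (F := fun p t => momentDiff d p * orthantTerm e p (t 0) (t 1))
    (f := fun t => g t / e !)
    (fun p => (integrableOn_orthantTerm e p).const_mul _) ?_ ?_
  · simp only [integral_const_mul, integral_orthantTerm, integral_div] at key
    have hint : IntegrableOn g (orthant 2) := by
      have := key.1.mul_const (e ! : ℝ)
      refine (integrable_congr (Eventually.of_forall fun t => ?_)).1 this
      exact div_mul_cancel₀ _ (by positivity)
    have hcongr : Set.EqOn (etaIntegrand ![1, d + 1] ![1, e + 1]) (fun t => (g t : ℂ))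
        (orthant 2) :=
      fun t ht => etaIntegrand_eq d e ht
    refine ⟨(integrableOn_congr_fun hcongr measurableSet_orthant_two).2 hint.ofReal, ?_⟩
    rw [eta, setIntegral_congr_fun measurableSet_orthant_two hcongr, integral_complex_ofReal,
      key.2.tsum_eq, Fin.prod_univ_two]
    have h1 : Complex.Gamma ((e + 1 : ℕ) : ℂ) = e ! := by
      push_cast; exact Complex.Gamma_nat_eq_factorial e
    simp only [Matrix.cons_val_zero, Matrix.cons_val_one, h1, Nat.cast_one, Complex.Gamma_one]
    push_cast
    ring
  · refine h.congr fun p => ?_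
    rw [← integral_orthantTerm e p, ← integral_const_mul]
    refine setIntegral_congr_fun measurableSet_orthant_two fun t ht => ?_
    exact (Real.norm_of_nonneg
      (mul_nonneg (momentDiff_nonneg d p) (orthantTerm_nonneg e p (ht 0) (ht 1)))).symm
  · refine (ae_restrict_iff' measurableSet_orthant_two).2 (Eventually.of_forall fun t ht => ?_)
    have h1 := (hasSum_integral_etaKernel d (s := t 0 + t 1) (add_pos (ht 0) (ht 1))
      (ht 1)).mul_right (t 1 ^ e / e !)
    rw [← mul_div_assoc] at h1
    refine hasSum_of_eq h1 fun p => ?_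
    rw [orthantTerm, gammaWeight]
    ring

/-! ### Evaluation of the double series -/

lemma starSum_nonneg (d n : ℕ) : 0 ≤ starSum d n := by
  induction d generalizing n with
  | zero => exact HarmonicWord.unit.nonneg n
  | succ d ih =>
    exact add_nonneg (Finset.sum_nonneg (s := Finset.range n)
      fun m _ => div_nonneg (ih m) m.cast_nonneg) (div_nonneg (ih n) n.cast_nonneg)

lemma divIdx_starSum_nonneg (d n : ℕ) : 0 ≤ divIdx (starSum d) n :=
  div_nonneg (starSum_nonneg d n) n.cast_nonneg

lemma divIdx_starSum_mem (d : ℕ) : divIdx (starSum d) ∈ harmonicSpan true (d + 1) := by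
  induction d with
  | zero => exact HarmonicWord.unit.div.mem
  | succ d ih =>
    rw [starSum, map_add]
    exact add_mem (divIdx_mem (partialSum_mem ih)) (divIdx_mem ih)

lemma divIdx_starSum_mul_mem (d : ℕ) {w : ℕ} {f : ℕ → ℝ} (hf : f ∈ harmonicSpan true w) :
    divIdx (starSum d) * f ∈ summableSpan (d + w) := by
  cases d with
  | zero =>
    rw [divIdx_mul, starSum, posOne_mul (map_zero_of_mem hf), zero_add]
    exact ⟨f, hf, rfl⟩
  | succ d =>
    rw [starSum, map_add, add_mul]
    exact add_mem
      (divIdx_mul_mem_summableSpan rfl (partialSum_mem (divIdx_starSum_mem d)) hf)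
      (divIdx_mul_mem_summableSpan rfl (divIdx_starSum_mem d) hf)

lemma hasSum_mul_of_mem {a b : ℕ} {f g : ℕ → ℝ} (hf : f ∈ summableSpan a) (hg : g ∈ summableSpan b)
    (hf0 : ∀ n, 0 ≤ f n) (hg0 : ∀ n, 0 ≤ g n) :
    ∃ x ∈ mzvSpan (a + b + 2), HasSum (fun p : ℕ × ℕ => f p.1 * g p.2) x := by
  obtain ⟨hfs, -⟩ := summable_and_tsum_mem hf
  obtain ⟨hgs, -⟩ := summable_and_tsum_mem hg
  refine ⟨_, ?_, hfs.hasSum.mul hgs.hasSum (hfs.mul_of_nonneg hgs hf0 hg0)⟩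
  -- the product of the partial sums is again a sequence of partial sums
  have h : f * partialSum g + partialSum f * g + f * g ∈ summableSpan (a + b + 1) := by
    have hf' := summableSpan_le a hf
    have hg' := summableSpan_le b hg
    obtain ⟨f, hf, rfl⟩ := hf
    obtain ⟨g, hg, rfl⟩ := hg
    refine add_mem (add_mem ?_ ?_) ?_
    · have := divIdx_mul_mem_summableSpan rfl hf (partialSum_mem hg')
      rwa [← add_assoc] at this
    · rw [mul_comm, show a + b + 1 = b + (a + 1) by omega]
      have := divIdx_mul_mem_summableSpan rfl hg (partialSum_mem hf')
      exact this
    · have := divIdx_mul_mem_summableSpan rfl hf hg'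
      rwa [← add_assoc] at this
  obtain ⟨hs, hm⟩ := summable_and_tsum_mem h
  have h1 := hfs.hasSum.tendsto_sum_nat.mul hgs.hasSum.tendsto_sum_nat
  have h2 := hs.hasSum.tendsto_sum_nat
  rw [tendsto_nhds_unique h1 (h2.congr fun n =>
    (congrFun (partialSum_mul_partialSum f g) n).symm)]
  exact hm

lemma hasSum_of_mul_convBy_mem {w : ℕ} {a f g : ℕ → ℝ} (ha : ∀ n, 0 ≤ a n) (hf : ∀ n, 0 ≤ f n)
    (hg : ∀ n, 0 ≤ g n) (h : g * convBy a f ∈ summableSpan w) :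
    ∃ x ∈ mzvSpan (w + 1), HasSum (fun p : ℕ × ℕ => a p.1 * f p.2 * g (p.1 + p.2)) x := by
  obtain ⟨hs, hm⟩ := summable_and_tsum_mem h
  refine ⟨_, hm, ?_⟩
  set F : ℕ × ℕ → ℝ := fun p => a p.1 * f p.2 * g (p.1 + p.2) with hF
  have hF0 : ∀ p, 0 ≤ F p := fun p => mul_nonneg (mul_nonneg (ha _) (hf _)) (hg _)
  let e := Finset.HasAntidiagonal.sigmaAntidiagonalEquivProd (A := ℕ)
  have hfib : ∀ n, HasSum (fun c : Finset.HasAntidiagonal.antidiagonal n => F (e ⟨n, c⟩))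
      ((g * convBy a f) n) := fun n => by
    have e1 : (g * convBy a f) n = ∑ p ∈ Finset.HasAntidiagonal.antidiagonal n, F p := by
      rw [Pi.mul_apply, convBy_apply, Finset.mul_sum]
      refine Finset.sum_congr rfl fun p hp => ?_
      rw [hF, ← Finset.HasAntidiagonal.mem_antidiagonal.1 hp, mul_comm]
    rw [e1, ← Finset.sum_coe_sort]
    exact hasSum_fintype _
  have hsig : Summable (F ∘ e) :=
    (summable_sigma_of_nonneg fun c => hF0 _).2
      ⟨fun n => (hfib n).summable, hs.congr fun n => (hfib n).tsum_eq.symm⟩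
  rw [← e.hasSum_iff]
  have : ∑' n, (g * convBy a f) n = ∑' c, (F ∘ e) c := by
    rw [hsig.tsum_sigma' fun n => (hfib n).summable]
    exact tsum_congr fun n => (hfib n).tsum_eq.symm
  rw [this]
  exact hsig.hasSum

/-- The double series splits into four convergent ones. After `m = i + 1` and `n = j + 1`, it is the
sum of `(A n - A (m + n)) (B n - B (m + n)) / m ^ 2` over `m, n ≥ 1`. -/
lemma hasSum_momentDiff_mul (d e : ℕ) :
    ∃ x ∈ mzvSpan (d + 1 + (e + 1) + 2),
      HasSum (fun p : ℕ × ℕ => momentDiff d p * momentDiff e p) x := by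
  set A := divIdx (starSum d) with hA
  set B := divIdx (starSum e) with hB
  set q := divIdx (divIdx posOne) with hq
  have hA0 : ∀ n, 0 ≤ A n := divIdx_starSum_nonneg d
  have hB0 : ∀ n, 0 ≤ B n := divIdx_starSum_nonneg e
  have hq0 : ∀ n, 0 ≤ q n := HarmonicWord.unit.div.div.nonneg
  have hAm : A ∈ harmonicSpan true (d + 1) := divIdx_starSum_mem d
  have hBm : B ∈ harmonicSpan true (e + 1) := divIdx_starSum_mem e
  have hqm : q ∈ summableSpan 1 := ⟨_, HarmonicWord.unit.div.mem, rfl⟩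
  obtain ⟨x₁, hx₁, h₁⟩ := hasSum_mul_of_mem hqm (divIdx_starSum_mul_mem d hBm) hq0
    fun n => mul_nonneg (hA0 n) (hB0 n)
  obtain ⟨x₂, hx₂, h₂⟩ := hasSum_of_mul_convBy_mem hq0 hA0 hB0
    (divIdx_starSum_mul_mem e (convBy_inv_sq_mem hAm))
  obtain ⟨x₃, hx₃, h₃⟩ := hasSum_of_mul_convBy_mem hq0 hB0 hA0
    (divIdx_starSum_mul_mem d (convBy_inv_sq_mem hBm))
  have hBu := mul_mem_harmonicSpan hBm (convBy_inv_sq_mem HarmonicWord.unit.mem)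
  obtain ⟨x₄, hx₄, h₄⟩ := hasSum_of_mul_convBy_mem (f := posOne) (g := A * B) hq0
    HarmonicWord.unit.nonneg (fun n => mul_nonneg (hA0 n) (hB0 n)) (by
      rw [mul_assoc]
      exact divIdx_starSum_mul_mem d hBu)
  refine ⟨x₁ - x₂ - x₃ + x₄, ?_, ?_⟩
  · rw [show 1 + (d + (e + 1)) + 2 = d + 1 + (e + 1) + 2 by omega] at hx₁
    rw [show e + (d + 1 + 2) + 1 = d + 1 + (e + 1) + 2 by omega] at hx₂
    rw [show d + (e + 1 + 2) + 1 = d + 1 + (e + 1) + 2 by omega] at hx₃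
    rw [show d + (e + 1 + (0 + 2)) + 1 = d + 1 + (e + 1) + 2 by omega] at hx₄
    exact add_mem (sub_mem (sub_mem hx₁ hx₂) hx₃) hx₄
  · have h := ((h₁.sub h₂).sub h₃).add h₄
    have hinj : Function.Injective fun p : ℕ × ℕ => (p.1 + 1, p.2 + 1) := fun p p' h => by
      simpa [Prod.ext_iff] using h
    rw [← hinj.hasSum_iff] at h
    · refine hasSum_of_eq h fun p => ?_
      have e1 : p.1 + 1 + (p.2 + 1) = p.1 + p.2 + 2 := by omega
      simp only [Function.comp_apply, Pi.mul_apply, momentDiff, e1, ← hA, ← hB]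
      simp only [hq, divIdx_apply (divIdx posOne), divIdx_apply posOne, posOne, Nat.succ_ne_zero,
        if_false, Nat.cast_add, Nat.cast_one]
      field_simp
      ring
    · -- the terms with `m = 0` or `n = 0` vanish
      rintro ⟨m, n⟩ hmn
      rcases Nat.eq_zero_or_pos m with rfl | hm
      · simp [hq, divIdx_apply]
      rcases Nat.eq_zero_or_pos n with rfl | hn
      · simp [hA, hB, divIdx_apply, posOne]
      · exact absurd ⟨(m - 1, n - 1), by simp; omega⟩ hmn

end EtaMZV

/-- For positive integers `k`, `l` the integral defining `η(1,k;1,l)` converges absolutely, and its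
value is a real number in the `ℚ`-span of the multiple zeta values of weight `k+l+2`. -/
theorem theorem4p5 (k l : ℕ) (hk : 0 < k) (hl : 0 < l) :
    IntegrableOn (EtaMZV.etaIntegrand ![1, k] ![1, l]) (EtaMZV.orthant 2) ∧
      ∃ x ∈ EtaMZV.mzvSpan (k + l + 2), EtaMZV.eta ![1, k] ![1, l] = (x : ℂ) := by
  obtain ⟨d, rfl⟩ := Nat.exists_eq_add_of_lt hk
  obtain ⟨e, rfl⟩ := Nat.exists_eq_add_of_lt hl
  rw [zero_add, zero_add]
  obtain ⟨x, hx, hs⟩ := EtaMZV.hasSum_momentDiff_mul d e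
  obtain ⟨h1, h2⟩ := EtaMZV.integrableOn_and_eta_eq d e hs.summable
  exact ⟨h1, x, hx, by rw [h2, hs.tsum_eq]⟩
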